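/- There are real algebraic numbers $\alpha=-0.0311\ldots$, $\beta=-0.4088\ldots$, $\gamma=0.3983\ldots$ (truncated decimal expansions) for which the polynomial $$\begin{aligned}\pi(t)={}&(-96\alpha-96\beta-48\alpha\beta-192\gamma-96\alpha\gamma-96\beta\gamma+99\alpha\beta\gamma)\\ &+t(-1392\alpha-1296\beta-96\alpha\beta-1696\gamma-1624\alpha\gamma-952\beta\gamma+1370\alpha\beta\gamma)\\ &+t^2(-256-8608\alpha-5488\beta+1172\alpha\beta-5536\gamma-10240\alpha\gamma-2164\beta\gamma+4292\alpha\beta\gamma)\\ &+t^3(-2944-25648\alpha-8512\beta+4100\alpha\beta-8192\gamma-21056\alpha\gamma-1736\beta\gamma+4768\alpha\beta\gamma)\\ &+t^4(-8576-32288\alpha-4832\beta+4072\alpha\beta-2912\gamma-12608\alpha\gamma-440\beta\gamma+1744\alpha\beta\gamma)\\ &+t^5(-3584-11648\alpha-896\beta+1120\alpha\beta)\end{aligned}$$ equals $(-t-2)u(t)^2$ for some $u\in\mathbb{R}[t]$ of degree two that has a root $\tau=0.1765\ldots$, and such that the following statements hold for the field $\mathcal F=\mathbb{Q}(\alpha,\beta,\gamma)\subset\mathbb{R}$.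 (1) $\tau\notin\mathcal F$. (2) Let $\Omega(\tau)=\frac{1}{4+4\tau}(1+\tau,\,1+2\tau,\,1+\tau,\,1,\,0)$. In the affine hyperplane $x_1+\dots+x_5=1$ of $\mathbb{R}^5$ there are polytopes $P\subset Q$, both of dimension $4$, all of whose vertices have coordinates in $\mathcal F$, such that there is exactly one simplex $\Delta$ with $P\subset\Delta\subset Q$; moreover, $\Omega(\tau)$ is a vertex of $\Delta$, and not all coordinates of $\Omega(\tau)$ belong to $\mathcal F$. (3) There is a nonnegative matrix $A$ with entries in $\mathcal F$ such that $\operatorname{rank}_+(A,\mathbb{R})=5$ and $\operatorname{rank}_+(A,\mathcal F)\neq\operatorname{rank}_+(A,\mathbb{R})$. Here, for a subfield $\mathcal K\subset\mathbb{R}$ and a nonnegative matrix $A$ over $\mathcal K$, $\operatorname{rank}_+(A,\mathcal K)$ denotes the smallest $k$ such that $A$ is a sum of $k$ nonnegative rank-one matrices with entries in $\mathcal K$. -/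

import Mathlib

open Polynomial

noncomputable section

namespace NonnegRankField

/-- `ratExt α β γ` is the subfield `ℚ(α, β, γ)` of `ℝ`. -/
def ratExt (α β γ : ℝ) : Subfield ℝ :=
  (IntermediateField.adjoin ℚ ({α, β, γ} : Set ℝ)).toSubfield

/-- `A` is a sum of `k` nonnegative rank-one matrices with entries in `F`. -/
def IsNonnegRankOneSum {m n : ℕ} (F : Subfield ℝ) (A : Matrix (Fin m) (Fin n) ℝ) (k : ℕ) : Prop :=
  ∃ M : Fin k → Matrix (Fin m) (Fin n) ℝ,
    (∀ l, (M l).rank = 1 ∧ ∀ i j, M l i j ∈ F ∧ 0 ≤ M l i j) ∧ A = ∑ l, M l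

/-- The nonnegative rank `rank₊(A, F)`, intended for a nonnegative matrix `A` with entries in the
field `F ⊆ ℝ`; for such a matrix the set below is nonempty, because `A` is the sum of its
nonzero entries, each placed in a matrix that is zero elsewhere. -/
def nonnegRank {m n : ℕ} (F : Subfield ℝ) (A : Matrix (Fin m) (Fin n) ℝ) : ℕ :=
  sInf {k : ℕ | IsNonnegRankOneSum F A k}

/-- A polytope: the convex hull of finitely many points. -/
def IsPolytope {d : ℕ} (P : Set (Fin d → ℝ)) : Prop :=
  ∃ V : Set (Fin d → ℝ), V.Finite ∧ P = convexHull ℝ V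

/-- A simplex (of any dimension): the convex hull of finitely many, and at least one,
affinely independent points. -/
def IsSimplex {d : ℕ} (S : Set (Fin d → ℝ)) : Prop :=
  ∃ (n : ℕ) (s : Affine.Simplex ℝ (Fin d → ℝ) n), S = convexHull ℝ (Set.range s.points)

/-- Every vertex (extreme point) of `P` has all its coordinates in `F`. -/
def VerticesIn {d : ℕ} (F : Subfield ℝ) (P : Set (Fin d → ℝ)) : Prop :=
  ∀ v ∈ P.extremePoints ℝ, ∀ i, v i ∈ F

/-- The dimension of (the affine span of) `P`. -/
def polyDim {d : ℕ} (P : Set (Fin d → ℝ)) : ℕ :=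
  Module.finrank ℝ (vectorSpan ℝ P)

/-- The affine hyperplane `x₁ + ⋯ + x₅ = 1` of `ℝ⁵`. -/
def sumOne : Set (Fin 5 → ℝ) := {x | ∑ i, x i = 1}

/-- The point `Ω(t)`: the vector `(1 + t, 1 + 2t, 1 + t, 1, 0)`, scaled so that its coordinates
sum to `1`. -/
def Omega (t : ℝ) : Fin 5 → ℝ :=
  (4 + 4 * t)⁻¹ • ![1 + t, 1 + 2 * t, 1 + t, 1, 0]

/-- The polynomial `π(t)` whose factorization determines `α, β, γ`. -/
def piPoly (α β γ : ℝ) : ℝ[X] :=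
  C (-96 * α - 96 * β - 48 * α * β - 192 * γ - 96 * α * γ - 96 * β * γ + 99 * α * β * γ)
  + C (-1392 * α - 1296 * β - 96 * α * β - 1696 * γ - 1624 * α * γ - 952 * β * γ
      + 1370 * α * β * γ) * X
  + C (-256 - 8608 * α - 5488 * β + 1172 * α * β - 5536 * γ - 10240 * α * γ - 2164 * β * γ
      + 4292 * α * β * γ) * X ^ 2
  + C (-2944 - 25648 * α - 8512 * β + 4100 * α * β - 8192 * γ - 21056 * α * γ - 1736 * β * γ
      + 4768 * α * β * γ) * X ^ 3
  + C (-8576 - 32288 * α - 4832 * β + 4072 * α * β - 2912 * γ - 12608 * α * γ - 440 * β * γ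
      + 1744 * α * β * γ) * X ^ 4
  + C (-3584 - 11648 * α - 896 * β + 1120 * α * β) * X ^ 5

/-- The explicit data: `α = -0.0311…`, `β = -0.4088…`, `γ = 0.3983…` make `π` equal to
`(-t - 2) u²` with `u` a real polynomial of degree two, and `τ = 0.1765…` is a root of `u`. -/
def IsExplicitData (α β γ τ : ℝ) : Prop :=
  α ∈ Set.Ioc (-0.0312 : ℝ) (-0.0311) ∧ β ∈ Set.Ioc (-0.4089 : ℝ) (-0.4088) ∧
  γ ∈ Set.Ico (0.3983 : ℝ) 0.3984 ∧ τ ∈ Set.Ico (0.1765 : ℝ) 0.1766 ∧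
  ∃ u : ℝ[X], u.natDegree = 2 ∧ piPoly α β γ = (-X - 2) * u ^ 2 ∧ u.IsRoot τ

end NonnegRankField

end

open Polynomial

noncomputable section

namespace NonnegRankField

/-! The proof has two halves, joined by a single fact: `τ ∈ (0, 1/2)` is quadratic over `F`, and its
conjugate `τ'` lies in `[-3/8, 0)`.

Geometry. Put `t = τ + 1/2`, `s = τ' + 1/2` and `v_k = e_k + t e_{k+1}` (indices mod 5). The points
`v_k + s v_{k+1}` involve only `t + s` and `t s`, so they are defined over `F`, while the `v_k` are
not. By `cone_rigidity`, at most five vectors in the outer cone (coordinates and `cycForm`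
nonnegative) whose cone contains these points and `outerPt` must be the `v_k` up to scaling. The
zeros of the points and the inequalities force supports of two or three consecutive indices, and
counting leaves five triples or five pairs. Triples are multiples of the points themselves, and
their cone misses `outerPt`. For pairs, the slopes satisfy `z_k + t s / z_{k+1} = t + s`; since `z_k
≥ 1/2 > s`, any deviation from `t` would grow strictly around the cycle, so every slope is `t`.
Hence the simplex is unique, and a nonnegative factorization of size five over `F` would put `t`
into `F`. A linear change of coordinates moves `v_0` onto the ray of `Ω(τ)`.

Arithmetic. Everything lives in `ℚ(x)`, with `x` a root of `fieldPoly`, `β = 2 - 6x`, `α` a rational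
function of `x`, and `γ` the function of `β` that makes `t + 2` divide `π`. That the quartic
cofactor is a constant times a square amounts to two divisibilities by `fieldPoly`. The discriminant
of the quadratic factor is negative at another real root of `fieldPoly`; as `fieldPoly` is
irreducible (it takes a prime value far from its roots), the discriminant is no square in `ℚ(x)`,
and `τ ∉ F`. -/

/-! ### Five vectors arranged in a cycle -/

/-- The vector `e_k + t e_{k+1}`, indices modulo `5`. -/
def cycVec (t : ℝ) (k : Fin 5) : Fin 5 → ℝ :=
  fun i => if i = k then 1 else if i = k + 1 then t else 0

/-- The vector `e_k + b e_{k+1} + g e_{k+2}`, indices modulo `5`. -/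
def cycPt (b g : ℝ) (k : Fin 5) : Fin 5 → ℝ :=
  fun i => if i = k then 1 else if i = k + 1 then b else if i = k + 2 then g else 0

/-- A combination of three consecutive points `cycPt`, outside of the cone they span. -/
def outerPt (b g : ℝ) : Fin 5 → ℝ :=
  cycPt b g 0 - (1 / 8 : ℝ) • cycPt b g 1 + (1 / 8 * b) • cycPt b g 2

/-- The linear functionals that, with the coordinates, bound the outer polytope. -/
def cycForm (i : Fin 5) (x : Fin 5 → ℝ) : ℝ := x (i + 1) - x i / 2 + x (i - 1) / 2

/-- `y` is a nonnegative combination of the vectors `w j`. -/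
def InCone {ι : Type*} [Fintype ι] (w : ι → Fin 5 → ℝ) (y : Fin 5 → ℝ) : Prop :=
  ∃ d : ι → ℝ, (∀ j, 0 ≤ d j) ∧ ∑ j, d j • w j = y

/-- One turn around the cycle multiplies `y k` by `(-s) ^ 5`. The length is odd, so the obstruction
is `1 + s ^ 5`, which is positive. -/
theorem eq_zero_of_cyclic {y : Fin 5 → ℝ} {s : ℝ} (hs : 0 < s)
    (h : ∀ k, y (k + 1) + s * y k = 0) : y = 0 := by
  have h0 := h 0; have h1 := h 1; have h2 := h 2; have h3 := h 3; have h4 := h 4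
  simp only [Fin.isValue, Fin.reduceAdd] at h0 h1 h2 h3 h4
  have e : y 0 * (1 + s ^ 5) = 0 := by
    linear_combination h4 - s * h3 + s ^ 2 * h2 - s ^ 3 * h1 + s ^ 4 * h0
  have y0 : y 0 = 0 := by
    rcases mul_eq_zero.1 e with h | h
    · exact h
    · have : 0 < 1 + s ^ 5 := by positivity
      linarith
  have y1 : y 1 = 0 := by rw [y0] at h0; linarith
  have y2 : y 2 = 0 := by rw [y1] at h1; linarith
  have y3 : y 3 = 0 := by rw [y2] at h2; linarith
  have y4 : y 4 = 0 := by rw [y3] at h3; linarith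
  funext k
  fin_cases k <;> simpa

theorem cycVec_linearIndependent {t : ℝ} (ht : 0 < t) : LinearIndependent ℝ (cycVec t) := by
  rw [Fintype.linearIndependent_iff]
  intro c hc
  have : c = 0 := by
    refine eq_zero_of_cyclic ht fun k => ?_
    have := congrFun hc (k + 1)
    simp only [Finset.sum_apply, Pi.smul_apply, cycVec, smul_eq_mul, Fin.sum_univ_five] at this
    fin_cases k <;> simp at this ⊢ <;> linarith
  intro i; rw [this]; rfl

theorem cycPt_eq (t s : ℝ) (k : Fin 5) :
    cycPt (t + s) (t * s) k = cycVec t k + s • cycVec t (k + 1) := by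
  funext i
  simp only [cycPt, cycVec, Pi.add_apply, Pi.smul_apply, smul_eq_mul]
  fin_cases k <;> fin_cases i <;> simp <;> ring

/-- Relative to the basis `cycVec t` the points have the same cyclic shape with `s` in place of `t`,
so the cyclic argument applies twice. -/
theorem cycPt_linearIndependent {t s : ℝ} (ht : 0 < t) (hs : 0 < s) :
    LinearIndependent ℝ (cycPt (t + s) (t * s)) := by
  rw [Fintype.linearIndependent_iff]
  intro c hc
  have hv := Fintype.linearIndependent_iff.1 (cycVec_linearIndependent ht)
    (fun k => c k + s * c (k - 1)) (by
      rw [← hc]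
      simp only [cycPt_eq, Fin.sum_univ_five, smul_add, add_smul, smul_smul]
      simp [show (-1 : Fin 5) = 4 from rfl]
      module)
  have : c = 0 := by
    refine eq_zero_of_cyclic hs fun k => ?_
    simpa using hv (k + 1)
  intro i; rw [this]; rfl

/-- The coefficients are nonnegative once `1 / 8 ≤ s`; this is the source of the bound `-(3 / 8) ≤
τ'`. -/
theorem outerPt_eq (t s : ℝ) : outerPt (t + s) (t * s) = cycVec t 0 + (s - 1 / 8) • cycVec t 1
    + (t / 8) • cycVec t 2 + ((t + s) * s / 8) • cycVec t 3 := by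
  simp only [outerPt, cycPt_eq]
  simp
  module

theorem outerPt_not_inCone {t s : ℝ} (ht : 0 < t) (hs : 0 < s) :
    ¬ InCone (cycPt (t + s) (t * s)) (outerPt (t + s) (t * s)) := by
  rintro ⟨d, hd, h⟩
  have := Fintype.linearIndependent_iff.1 (cycPt_linearIndependent ht hs)
    (fun k => d k - ![1, -(1 / 8), 1 / 8 * (t + s), 0, 0] k) (by
      simp only [sub_smul, Finset.sum_sub_distrib, h]
      simp [Fin.sum_univ_five, outerPt]
      module) 1
  simp at this
  linarith [hd 1]

/-- Here `a` and `b` stand for the positions of triples and of pairs. A nonempty proper subset of a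
cycle together with its shift has at least one element more than the subset, so a mixed
configuration needs at least six vectors. -/
theorem cover_dichotomy : ∀ a b : Finset (Fin 5), (∀ k, k ∈ a ∨ (k ∈ b ∧ k + 1 ∈ b)) →
    a.card + b.card ≤ 5 → (a = Finset.univ ∧ b = ∅) ∨ (a = ∅ ∧ b = Finset.univ) := by
  decide +kernel

/-- The recursion gives `(z (k+1) - t) (t + s - z k) = t (z k - t)` with `0 < t + s - z k < t`. So
the distance to `t` increases strictly unless it is zero, which is impossible around a cycle. -/
theorem cyc_monotone {t s : ℝ} (hs : 0 < s) (hst : s < 1 / 2) (ht : 1 / 2 < t)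
    {z : Fin 5 → ℝ} (hz : ∀ k, 1 / 2 ≤ z k)
    (h : ∀ k, z k + t * s / z (k + 1) = t + s) : ∀ k, z k = t := by
  have key : ∀ k, |z k - t| ≤ |z (k + 1) - t| ∧ (z k ≠ t → |z k - t| < |z (k + 1) - t|) := by
    intro k
    have hp : 0 < z (k + 1) := by linarith [hz (k + 1)]
    have h1 : z (k + 1) * (t + s - z k) = t * s := by
      have := h k; field_simp at this; linarith
    have hpos : 0 < t + s - z k := by
      by_contra hn
      have : 0 < t * s := by nlinarith
      nlinarith
    have h2 : (z (k + 1) - t) * (t + s - z k) = t * (z k - t) := by linarith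
    have h3 : |z (k + 1) - t| * (t + s - z k) = t * |z k - t| := by
      rw [← abs_of_pos hpos, ← abs_mul, h2, abs_mul, abs_of_pos (by linarith : 0 < t)]
    have h4 : t + s - z k < t := by linarith [hz k]
    constructor
    · by_contra hn
      push Not at hn
      nlinarith [abs_nonneg (z k - t), abs_nonneg (z (k + 1) - t)]
    · intro hne
      have : 0 < |z k - t| := abs_pos.2 (sub_ne_zero.2 hne)
      by_contra hn
      push Not at hn
      nlinarith [abs_nonneg (z (k + 1) - t)]
  by_contra hcon
  push Not at hcon
  obtain ⟨k, hk⟩ := hcon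
  have e := (key k).2 hk
  have e1 := (key (k + 1)).1
  have e2 := (key (k + 1 + 1)).1
  have e3 := (key (k + 1 + 1 + 1)).1
  have e4 := (key (k + 1 + 1 + 1 + 1)).1
  have : k + 1 + 1 + 1 + 1 + 1 = k := by fin_cases k <;> rfl
  rw [this] at e4
  linarith

/-- The support of `w` is `{k, k+1}`. -/
def IsPair (w : Fin 5 → ℝ) (k : Fin 5) : Prop :=
  0 < w k ∧ 0 < w (k + 1) ∧ w (k + 2) = 0 ∧ w (k + 3) = 0 ∧ w (k + 4) = 0

/-- The support of `w` is `{k, k+1, k+2}`. -/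
def IsTriple (w : Fin 5 → ℝ) (k : Fin 5) : Prop :=
  0 < w k ∧ 0 < w (k + 1) ∧ 0 < w (k + 2) ∧ w (k + 3) = 0 ∧ w (k + 4) = 0

theorem IsPair.unique {w : Fin 5 → ℝ} {k l : Fin 5} (hk : IsPair w k) (hl : IsPair w l) :
    k = l := by
  revert hk hl
  unfold IsPair
  fin_cases k <;> fin_cases l <;> simp <;> intros <;> linarith

theorem IsTriple.unique {w : Fin 5 → ℝ} {k l : Fin 5} (hk : IsTriple w k) (hl : IsTriple w l) :
    k = l := by
  revert hk hl
  unfold IsTriple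
  fin_cases k <;> fin_cases l <;> simp <;> intros <;> linarith

theorem IsPair.not_isTriple {w : Fin 5 → ℝ} {k l : Fin 5} (hk : IsPair w k) :
    ¬ IsTriple w l := by
  revert hk
  unfold IsPair IsTriple
  fin_cases k <;> fin_cases l <;> simp <;> intros <;> linarith

/-- The forms at `k` and `k + 2` bound `w k` and `w (k + 2)` by multiples of `w (k + 1)`, so a zero
in the middle kills `w`. The form at `k + 1` forbids a middle entry standing alone. -/
theorem support_cases {w : Fin 5 → ℝ} (h0 : ∀ i, 0 ≤ w i) (hl : ∀ i, 0 ≤ cycForm i w) {k : Fin 5}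
    (h3 : w (k + 3) = 0) (h4 : w (k + 4) = 0) :
    w = 0 ∨ IsPair w k ∨ IsPair w (k + 1) ∨ IsTriple w k := by
  have a := hl k
  have b := hl (k + 1)
  have c := hl (k + 2)
  unfold cycForm at a b c
  have e1 : k + 1 + 1 = k + 2 := by fin_cases k <;> rfl
  have e2 : k + 2 + 1 = k + 3 := by fin_cases k <;> rfl
  have e3 : k + 1 - 1 = k := by fin_cases k <;> rfl
  have e4 : k + 2 - 1 = k + 1 := by fin_cases k <;> rfl
  have e5 : k - 1 = k + 4 := by fin_cases k <;> rfl
  have e6 : k + 1 + 2 = k + 3 := by fin_cases k <;> rfl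
  have e7 : k + 1 + 3 = k + 4 := by fin_cases k <;> rfl
  have e8 : k + 1 + 4 = k := by fin_cases k <;> rfl
  simp only [e1, e2, e3, e4, e5, h3, h4] at a b c
  have p0 := h0 k; have p1 := h0 (k + 1); have p2 := h0 (k + 2)
  unfold IsPair IsTriple
  simp only [e1, e6, e7, e8, h3, h4, and_true, true_and]
  rcases p1.eq_or_lt with q1 | q1
  · left
    have q0 : w k = 0 := by linarith
    have q2 : w (k + 2) = 0 := by linarith
    funext i
    have : i = k ∨ i = k + 1 ∨ i = k + 2 ∨ i = k + 3 ∨ i = k + 4 := by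
      fin_cases k <;> fin_cases i <;> decide
    rcases this with rfl | rfl | rfl | rfl | rfl <;> simp [*]
  · right
    rcases p0.eq_or_lt with q0 | q0 <;> rcases p2.eq_or_lt with q2 | q2
    · linarith
    · right; left; exact ⟨q1, q2, q0.symm⟩
    · left; exact ⟨q0, q1, q2.symm⟩
    · right; right; exact ⟨q0, q1, q2⟩

/-! ### Rigidity of cones with at most five generators -/

section Cone

variable {ι : Type*} [Fintype ι] {w : ι → Fin 5 → ℝ} {b g : ℝ}

theorem cone_vanish (h0 : ∀ j i, 0 ≤ w j i) {d : ι → ℝ} (hd : ∀ j, 0 ≤ d j) {y : Fin 5 → ℝ}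
    (h : ∑ j, d j • w j = y) {i : Fin 5} (hi : y i = 0) {j : ι} (hj : d j ≠ 0) : w j i = 0 := by
  have := congrFun h i
  simp only [Finset.sum_apply, Pi.smul_apply, smul_eq_mul, hi] at this
  rw [Finset.sum_eq_zero_iff_of_nonneg (fun j _ => mul_nonneg (hd j) (h0 j i))] at this
  exact (mul_eq_zero.1 (this j (Finset.mem_univ j))).resolve_left hj

theorem cone_pos {d : ι → ℝ} {y : Fin 5 → ℝ} (hd : ∀ j, 0 ≤ d j)
    (h : ∑ j, d j • w j = y) {i : Fin 5} (hi : 0 < y i) : ∃ j, d j ≠ 0 ∧ 0 < w j i := by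
  have := congrFun h i
  simp only [Finset.sum_apply, Pi.smul_apply, smul_eq_mul] at this
  rw [← this] at hi
  obtain ⟨j, -, hj⟩ := Finset.exists_lt_of_sum_lt (s := Finset.univ) (f := fun _ : ι => (0 : ℝ))
    (g := fun j => d j * w j i) (by simpa using hi)
  exact ⟨j, left_ne_zero_of_mul hj.ne', pos_of_mul_pos_right hj (hd j)⟩

theorem cycPt_apply (k : Fin 5) : cycPt b g k k = 1 ∧ cycPt b g k (k + 1) = b ∧
    cycPt b g k (k + 2) = g ∧ cycPt b g k (k + 3) = 0 ∧ cycPt b g k (k + 4) = 0 := by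
  unfold cycPt
  fin_cases k <;> simp

/-- Nothing cancels in a nonnegative combination, so each generator in use vanishes at `k + 3` and
`k + 4`. Without a triple, coordinate `k` must come from the pair at `k`, and coordinate `k + 2`
from the pair at `k + 1`. -/
theorem cone_dichotomy (hg : 0 < g) (h0 : ∀ j i, 0 ≤ w j i) (hl : ∀ j i, 0 ≤ cycForm i (w j))
    (hp : ∀ k, InCone w (cycPt b g k)) (k : Fin 5) :
    (∃ j, IsTriple (w j) k) ∨ ((∃ j, IsPair (w j) k) ∧ ∃ j, IsPair (w j) (k + 1)) := by
  obtain ⟨d, hd, h⟩ := hp k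
  obtain ⟨a0, a1, a2, a3, a4⟩ := cycPt_apply (b := b) (g := g) k
  by_cases hT : ∃ j, IsTriple (w j) k
  · exact Or.inl hT
  right
  have main : ∀ j, d j ≠ 0 → w j = 0 ∨ IsPair (w j) k ∨ IsPair (w j) (k + 1) := fun j hj => by
    rcases support_cases (h0 j) (hl j) (cone_vanish h0 hd h a3 hj) (cone_vanish h0 hd h a4 hj)
      with h | h | h | h
    · exact Or.inl h
    · exact Or.inr (Or.inl h)
    · exact Or.inr (Or.inr h)
    · exact absurd ⟨j, h⟩ hT
  constructor
  · obtain ⟨j, hj, hpos⟩ := cone_pos hd h (i := k) (by rw [a0]; norm_num)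
    rcases main j hj with h | h | h
    · simp [h] at hpos
    · exact ⟨j, h⟩
    · have := h.2.2.2.2
      rw [show k + 1 + 4 = k by fin_cases k <;> rfl] at this
      linarith
  · obtain ⟨j, hj, hpos⟩ := cone_pos hd h (i := k + 2) (by rw [a2]; exact hg)
    rcases main j hj with h | h | h
    · simp [h] at hpos
    · linarith [h.2.2.1]
    · exact ⟨j, h⟩

theorem all_triple_or_all_pair (hι : Fintype.card ι ≤ 5)
    (h : ∀ k, (∃ j, IsTriple (w j) k) ∨ ((∃ j, IsPair (w j) k) ∧ ∃ j, IsPair (w j) (k + 1))) :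
    (∃ σ : Fin 5 → ι, Function.Bijective σ ∧ ∀ k, IsTriple (w (σ k)) k) ∨
    (∃ σ : Fin 5 → ι, Function.Bijective σ ∧ ∀ k, IsPair (w (σ k)) k) := by
  classical
  let A : Finset (Fin 5) := Finset.univ.filter fun k => ∃ j, IsTriple (w j) k
  let B : Finset (Fin 5) := Finset.univ.filter fun k => ∃ j, IsPair (w j) k
  have hA : ∀ k : A, ∃ j, IsTriple (w j) k := fun k => (Finset.mem_filter.1 k.2).2
  have hB : ∀ k : B, ∃ j, IsPair (w j) k := fun k => (Finset.mem_filter.1 k.2).2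
  choose fA hfA using hA
  choose fB hfB using hB
  have inj : Function.Injective (Sum.elim fA fB) := by
    rintro (x | x) (y | y) hxy <;> simp only [Sum.elim_inl, Sum.elim_inr] at hxy
    · have := hfA x; rw [hxy] at this
      rw [Subtype.ext (this.unique (hfA y))]
    · have := hfA x; rw [hxy] at this
      exact absurd this (hfB y).not_isTriple
    · have := hfB x; rw [hxy] at this
      exact absurd (hfA y) this.not_isTriple
    · have := hfB x; rw [hxy] at this
      rw [Subtype.ext (this.unique (hfB y))]
  have hcard : A.card + B.card ≤ 5 := by
    have := Fintype.card_le_of_injective _ inj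
    simp only [Fintype.card_sum, Fintype.card_coe] at this
    omega
  have bij : ∀ σ : Fin 5 → ι, Function.Injective σ → Function.Bijective σ := fun σ hσ =>
    (Fintype.bijective_iff_injective_and_card σ).2 ⟨hσ, le_antisymm
      (Fintype.card_le_of_injective σ hσ) (by simpa using hι)⟩
  rcases cover_dichotomy A B (by simpa [A, B] using h) hcard with ⟨hA, -⟩ | ⟨-, hB⟩
  · left
    have hA : ∀ k, k ∈ A := by simp [hA]
    have hT : ∀ k, IsTriple (w (fA ⟨k, hA k⟩)) k := fun k => hfA ⟨k, hA k⟩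
    refine ⟨fun k => fA ⟨k, hA k⟩, bij _ fun x y hxy => ?_, hT⟩
    have := hT x
    rw [hxy] at this
    exact this.unique (hT y)
  · right
    have hB : ∀ k, k ∈ B := by simp [hB]
    have hT : ∀ k, IsPair (w (fB ⟨k, hB k⟩)) k := fun k => hfB ⟨k, hB k⟩
    refine ⟨fun k => fB ⟨k, hB k⟩, bij _ fun x y hxy => ?_, hT⟩
    have := hT x
    rw [hxy] at this
    exact this.unique (hT y)

/-- Among the triples only the one at `k` vanishes at `k + 3` and `k + 4`, so it alone produces
`cycPt b g k`, and the two are proportional. -/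
theorem inCone_of_triples {σ : Fin 5 → ι} (hσ : Function.Bijective σ)
    (hT : ∀ k, IsTriple (w (σ k)) k) (h0 : ∀ j i, 0 ≤ w j i)
    (hp : ∀ k, InCone w (cycPt b g k)) {y : Fin 5 → ℝ} (hy : InCone w y) :
    InCone (cycPt b g) y := by
  have hw : ∀ k, ∃ c : ℝ, 0 ≤ c ∧ w (σ k) = c • cycPt b g k := by
    intro k
    obtain ⟨d, hd, h⟩ := hp k
    obtain ⟨a0, -, -, a3, a4⟩ := cycPt_apply (b := b) (g := g) k
    have hz : ∀ j, j ≠ σ k → d j = 0 := by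
      intro j hj
      by_contra hne
      obtain ⟨l, rfl⟩ := hσ.2 j
      have v3 := cone_vanish h0 hd h a3 hne
      have v4 := cone_vanish h0 hd h a4 hne
      obtain ⟨p0, p1, p2, -, -⟩ := hT l
      have hl : l ≠ k := fun e => hj (by rw [e])
      revert v3 v4 p0 p1 p2 hl
      generalize w (σ l) = z
      fin_cases k <;> fin_cases l <;> simp <;> intros <;> linarith
    rw [Finset.sum_eq_single (σ k) (fun j _ hj => by rw [hz j hj, zero_smul]) (by simp)] at h
    have hd0 : d (σ k) ≠ 0 := by
      intro e
      have := congrFun h k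
      rw [e, a0] at this
      simp at this
    exact ⟨(d (σ k))⁻¹, inv_nonneg.2 (hd _), by rw [← h, smul_smul, inv_mul_cancel₀ hd0, one_smul]⟩
  choose c hc hw using hw
  obtain ⟨d, hd, h⟩ := hy
  refine ⟨fun k => d (σ k) * c k, fun k => mul_nonneg (hd _) (hc k), ?_⟩
  rw [← h, ← (Equiv.ofBijective σ hσ).sum_comp]
  refine Finset.sum_congr rfl fun k _ => ?_
  rw [Equiv.ofBijective_apply, hw, smul_smul]

theorem cone_rigidity {t s : ℝ} (hs : 0 < s) (hst : s < 1 / 2) (ht : 1 / 2 < t)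
    (hι : Fintype.card ι ≤ 5) (h0 : ∀ j i, 0 ≤ w j i) (hl : ∀ j i, 0 ≤ cycForm i (w j))
    (hp : ∀ k, InCone w (cycPt (t + s) (t * s) k)) (hq : InCone w (outerPt (t + s) (t * s))) :
    ∃ σ : Fin 5 → ι, Function.Bijective σ ∧ ∀ k, ∃ c : ℝ, 0 < c ∧ w (σ k) = c • cycVec t k := by
  have ht0 : 0 < t := by linarith
  have hg : 0 < t * s := mul_pos ht0 hs
  rcases all_triple_or_all_pair hι (cone_dichotomy hg h0 hl hp) with ⟨σ, hσ, hT⟩ | ⟨σ, hσ, hP⟩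
  · exact absurd (inCone_of_triples hσ hT h0 hp hq) (outerPt_not_inCone ht0 hs)
  refine ⟨σ, hσ, ?_⟩
  -- Only the pairs at `k` and `k + 1` contribute to the `k`-th point. Its three nonzero coordinates
  -- determine both coefficients and leave one relation between the slopes.
  have hz : ∀ k, w (σ k) (k + 1) / w (σ k) k + t * s / (w (σ (k + 1)) (k + 1 + 1) /
      w (σ (k + 1)) (k + 1)) = t + s := by
    intro k
    obtain ⟨d, hd, h⟩ := hp k
    obtain ⟨a0, a1, a2, a3, a4⟩ := cycPt_apply (b := t + s) (g := t * s) k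
    have hz : ∀ j, j ≠ σ k → j ≠ σ (k + 1) → d j = 0 := by
      intro j hj hj'
      by_contra hne
      obtain ⟨l, rfl⟩ := hσ.2 j
      have v3 := cone_vanish h0 hd h a3 hne
      have v4 := cone_vanish h0 hd h a4 hne
      obtain ⟨p0, p1, -, -, -⟩ := hP l
      have hl : l ≠ k := fun e => hj (by rw [e])
      have hl' : l ≠ k + 1 := fun e => hj' (by rw [e])
      revert v3 v4 p0 p1 hl hl'
      generalize w (σ l) = z
      fin_cases k <;> fin_cases l <;> simp <;> intros <;> linarith
    have hne : σ k ≠ σ (k + 1) := fun e => by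
      have := hσ.1 e
      revert this
      fin_cases k <;> decide
    rw [Finset.sum_eq_add (σ k) (σ (k + 1)) hne (fun j _ hj => by rw [hz j hj.1 hj.2, zero_smul])
      (by simp) (by simp)] at h
    obtain ⟨u0, u1, u2, -, -⟩ := hP k
    obtain ⟨x0, x1, -, -, x4⟩ := hP (k + 1)
    rw [show k + 1 + 4 = k by fin_cases k <;> rfl] at x4
    have e12 : k + 1 + 1 = k + 2 := by fin_cases k <;> rfl
    rw [e12] at x1 ⊢
    have f0 := congrFun h k
    have f1 := congrFun h (k + 1)
    have f2 := congrFun h (k + 2)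
    simp only [Pi.add_apply, Pi.smul_apply, smul_eq_mul, a0, a1, a2, x4, u2, mul_zero, add_zero,
      zero_add] at f0 f1 f2
    rw [div_div_eq_mul_div, div_add_div _ _ u0.ne' x1.ne', div_eq_iff (by positivity), ← f1, ← f2]
    linear_combination w (σ k) (k + 1) * w (σ (k + 1)) (k + 2) * (-f0)
  -- Entry `k - 1` of the pair vanishes, so the form at `k` bounds its slope below; this excludes
  -- the other fixed point `s`.
  have hzl : ∀ k, 1 / 2 ≤ w (σ k) (k + 1) / w (σ k) k := by
    intro k
    obtain ⟨u0, -, -, -, u4⟩ := hP k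
    have := hl (σ k) k
    unfold cycForm at this
    rw [show k - 1 = k + 4 by fin_cases k <;> rfl, u4] at this
    rw [le_div_iff₀ u0]
    linarith
  intro k
  have hk := cyc_monotone hs hst ht hzl hz k
  obtain ⟨u0, u1, u2, u3, u4⟩ := hP k
  refine ⟨w (σ k) k, u0, ?_⟩
  rw [div_eq_iff u0.ne'] at hk
  revert u0 u1 u2 u3 u4 hk
  generalize w (σ k) = z
  intro hk u0 u1 u2 u3 u4
  funext i
  have : i = k ∨ i = k + 1 ∨ i = k + 2 ∨ i = k + 3 ∨ i = k + 4 := by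
    fin_cases k <;> fin_cases i <;> decide
  simp only [cycVec, Pi.smul_apply, smul_eq_mul]
  rcases this with rfl | rfl | rfl | rfl | rfl
  · simp
  · simp [hk, mul_comm]
  all_goals
    fin_cases k <;> simp_all

end Cone

/-! ### The matrix -/

/-- The coordinates of `x`, followed by the values of the forms `cycForm i`. -/
def slack (x : Fin 5 → ℝ) : Fin (5 + 5) → ℝ := Fin.append x fun i => cycForm i x

theorem slack_castAdd (x : Fin 5 → ℝ) (i : Fin 5) : slack x (Fin.castAdd 5 i) = x i :=
  Fin.append_left _ _ i

theorem slack_natAdd (x : Fin 5 → ℝ) (i : Fin 5) : slack x (Fin.natAdd 5 i) = cycForm i x :=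
  Fin.append_right _ _ i

/-- The points `outerPt` and `cycPt`. -/
def innerPt (b g : ℝ) : Fin 6 → Fin 5 → ℝ := Fin.cons (outerPt b g) (cycPt b g)

/-- The coefficients that express the points `innerPt` by the vectors `cycVec t`. -/
def innerCoeff (t s : ℝ) : Fin 6 → Fin 5 → ℝ :=
  Fin.cons ![1, s - 1 / 8, t / 8, (t + s) * s / 8, 0] (cycVec s)

theorem slack_sum {ι : Type*} (S : Finset ι) (c : ι → ℝ) (x : ι → Fin 5 → ℝ) :
    slack (∑ k ∈ S, c k • x k) = ∑ k ∈ S, c k • slack (x k) := by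
  funext j
  induction j using Fin.addCases with
  | left j => simp [slack]
  | right j =>
    simp only [slack, Fin.append_right, Finset.sum_apply, Pi.smul_apply, cycForm, smul_eq_mul,
      Finset.sum_div, ← Finset.sum_sub_distrib, ← Finset.sum_add_distrib]
    exact Finset.sum_congr rfl fun k _ => by ring

theorem innerPt_eq (t s : ℝ) (r : Fin 6) :
    innerPt (t + s) (t * s) r = ∑ k, innerCoeff t s r k • cycVec t k := by
  induction r using Fin.cases with
  | zero =>
    simp only [innerPt, innerCoeff, Fin.cons_zero, outerPt_eq, Fin.sum_univ_five]
    simp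
  | succ k =>
    simp only [innerPt, innerCoeff, Fin.cons_succ, cycPt_eq, Fin.sum_univ_five]
    fin_cases k <;> (simp [cycVec]; try abel)

theorem innerCoeff_nonneg {t s : ℝ} (ht : 0 < t) (hs : 1 / 8 ≤ s) (r : Fin 6) (k : Fin 5) :
    0 ≤ innerCoeff t s r k := by
  have hs0 : 0 ≤ s := by linarith
  induction r using Fin.cases with
  | zero =>
    simp only [innerCoeff, Fin.cons_zero]
    fin_cases k <;> simp <;> first | positivity | linarith
  | succ i =>
    simp only [innerCoeff, Fin.cons_succ, cycVec]
    split_ifs <;> positivity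

theorem cycVec_nonneg {t : ℝ} (ht : 0 ≤ t) (k i : Fin 5) : 0 ≤ cycVec t k i := by
  unfold cycVec
  split_ifs <;> first | exact ht | norm_num

theorem cycForm_cycVec_nonneg {t : ℝ} (h0 : 1 / 2 ≤ t) (h1 : t ≤ 1) (k i : Fin 5) :
    0 ≤ cycForm i (cycVec t k) := by
  unfold cycForm cycVec
  fin_cases k <;> fin_cases i <;> simp [show (-1 : Fin 5) = 4 from rfl] <;> linarith

theorem slack_nonneg {x : Fin 5 → ℝ} (h0 : ∀ i, 0 ≤ x i) (hl : ∀ i, 0 ≤ cycForm i x)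
    (j : Fin (5 + 5)) : 0 ≤ slack x j := by
  induction j using Fin.addCases with
  | left j => rw [slack_castAdd]; exact h0 j
  | right j => rw [slack_natAdd]; exact hl j

/-- The matrix whose rows are the values of the coordinates and of the forms at `innerPt`. -/
def slackMatrix (b g : ℝ) : Matrix (Fin 6) (Fin (5 + 5)) ℝ :=
  Matrix.of fun r => slack (innerPt b g r)

theorem slackMatrix_eq (t s : ℝ) (r : Fin 6) (j : Fin (5 + 5)) :
    slackMatrix (t + s) (t * s) r j = ∑ k, innerCoeff t s r k * slack (cycVec t k) j := by
  simp only [slackMatrix, Matrix.of_apply, innerPt_eq, slack_sum]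
  simp

theorem slackMatrix_nonneg {t s : ℝ} (h0 : 1 / 2 < t) (h1 : t < 1) (hs : 1 / 8 ≤ s) (r : Fin 6)
    (j : Fin (5 + 5)) : 0 ≤ slackMatrix (t + s) (t * s) r j := by
  rw [slackMatrix_eq]
  exact Finset.sum_nonneg fun k _ => mul_nonneg (innerCoeff_nonneg (by linarith) hs r k)
    (slack_nonneg (cycVec_nonneg (by linarith) k) (cycForm_cycVec_nonneg h0.le h1.le k) j)

theorem cycPt_mem {F : Subfield ℝ} {b g : ℝ} (hb : b ∈ F) (hg : g ∈ F) (k i : Fin 5) :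
    cycPt b g k i ∈ F := by
  unfold cycPt
  split_ifs
  exacts [F.one_mem, hb, hg, F.zero_mem]

theorem innerPt_mem {F : Subfield ℝ} {b g : ℝ} (hb : b ∈ F) (hg : g ∈ F) (r : Fin 6) (i : Fin 5) :
    innerPt b g r i ∈ F := by
  have h8 : (1 / 8 : ℝ) ∈ F := F.div_mem F.one_mem (by exact_mod_cast natCast_mem F 8)
  induction r using Fin.cases with
  | zero =>
    simp only [innerPt, Fin.cons_zero, outerPt, Pi.add_apply, Pi.sub_apply, Pi.smul_apply,
      smul_eq_mul]
    exact F.add_mem (F.sub_mem (cycPt_mem hb hg _ _) (F.mul_mem h8 (cycPt_mem hb hg _ _)))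
      (F.mul_mem (F.mul_mem h8 hb) (cycPt_mem hb hg _ _))
  | succ k => simpa [innerPt] using cycPt_mem hb hg k i

theorem slackMatrix_mem {F : Subfield ℝ} {b g : ℝ} (hb : b ∈ F) (hg : g ∈ F) (r : Fin 6)
    (j : Fin (5 + 5)) : slackMatrix b g r j ∈ F := by
  have h2 : (2 : ℝ) ∈ F := by exact_mod_cast natCast_mem F 2
  have h := innerPt_mem hb hg r
  induction j using Fin.addCases with
  | left j => simpa [slackMatrix, slack] using h j
  | right j =>
    simp only [slackMatrix, slack, Matrix.of_apply, Fin.append_right, cycForm]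
    exact F.add_mem (F.sub_mem (h _) (F.div_mem (h _) h2)) (F.div_mem (h _) h2)

/-! ### Nonnegative factorizations of the slack matrix -/

theorem rank_one_factor {m n : ℕ} {F : Subfield ℝ} {M : Matrix (Fin m) (Fin n) ℝ}
    (hr : M.rank = 1) (hM : ∀ i j, M i j ∈ F ∧ 0 ≤ M i j) :
    ∃ (c : Fin m → ℝ) (b : Fin n → ℝ), (∀ i, 0 ≤ c i) ∧ (∀ j, b j ∈ F ∧ 0 ≤ b j) ∧
      ∀ i j, M i j = c i * b j := by
  have h0 : M ≠ 0 := by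
    rintro rfl
    simp at hr
  obtain ⟨i₀, j₀, hij⟩ : ∃ i j, M i j ≠ 0 := by
    by_contra! h
    exact h0 (Matrix.ext h)
  have hfin : Module.finrank ℝ (Submodule.span ℝ (Set.range M.row)) = 1 := by
    rw [← Matrix.rank_eq_finrank_span_row, hr]
  have hmem : ∀ i, M.row i ∈ Submodule.span ℝ (Set.range M.row) := fun i =>
    Submodule.subset_span ⟨i, rfl⟩
  have hne : (⟨M.row i₀, hmem i₀⟩ : Submodule.span ℝ (Set.range M.row)) ≠ 0 := by
    intro e
    exact hij (congrFun (congrArg Subtype.val e) j₀)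
  refine ⟨fun i => M i j₀ / M i₀ j₀, M i₀, fun i => div_nonneg (hM _ _).2 (hM _ _).2, hM i₀, ?_⟩
  intro i j
  obtain ⟨c, hc⟩ := (finrank_eq_one_iff_of_nonzero' _ hne).1 hfin ⟨M.row i, hmem i⟩
  have hc' : ∀ j, c * M i₀ j = M i j := fun j => congrFun (congrArg Subtype.val hc) j
  change M i j = M i j₀ / M i₀ j₀ * M i₀ j
  rw [← hc' j, ← hc' j₀, mul_div_assoc, div_self hij, mul_one]

theorem exists_factorization {m n k : ℕ} {F : Subfield ℝ} {A : Matrix (Fin m) (Fin n) ℝ}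
    (h : IsNonnegRankOneSum F A k) :
    ∃ (c : Fin k → Fin m → ℝ) (b : Fin k → Fin n → ℝ), (∀ l i, 0 ≤ c l i) ∧
      (∀ l j, b l j ∈ F ∧ 0 ≤ b l j) ∧ ∀ i j, A i j = ∑ l, c l i * b l j := by
  obtain ⟨M, hM, rfl⟩ := h
  choose c b hc hb h using fun l => rank_one_factor (hM l).1 (hM l).2
  refine ⟨c, b, hc, hb, fun i j => ?_⟩
  rw [Matrix.sum_apply]
  exact Finset.sum_congr rfl fun l _ => h l i j

/-- The rows of a factorization of `slackMatrix`, cut to the first five columns. -/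
theorem factor_mul {k : ℕ} {b' g : ℝ} {c : Fin k → Fin 6 → ℝ} {b : Fin k → Fin (5 + 5) → ℝ}
    (h : ∀ i j, slackMatrix b' g i j = ∑ l, c l i * b l j) :
    Matrix.of (cycPt b' g) = (Matrix.of fun r l => c l (Fin.succ r)) *
      (Matrix.of fun l (i : Fin 5) => b l (Fin.castAdd 5 i)) := by
  ext r i
  rw [Matrix.mul_apply]
  have := h r.succ (Fin.castAdd 5 i)
  simpa [slackMatrix, slack, innerPt] using this

theorem five_le_of_sum {t s : ℝ} (ht : 0 < t) (hs : 0 < s) {F : Subfield ℝ} {k : ℕ}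
    (h : IsNonnegRankOneSum F (slackMatrix (t + s) (t * s)) k) : 5 ≤ k := by
  obtain ⟨c, b, -, -, h⟩ := exists_factorization h
  have hm := factor_mul h
  have hr : (Matrix.of (cycPt (t + s) (t * s))).rank = 5 := by
    have : LinearIndependent ℝ (Matrix.of (cycPt (t + s) (t * s))).row :=
      cycPt_linearIndependent ht hs
    rw [this.rank_matrix, Fintype.card_fin]
  rw [← hr, hm]
  exact (Matrix.rank_mul_le_left _ _).trans (Matrix.rank_le_width _)

/-- The left factor, restricted to the rows of the `cycPt`, is invertible. This forces the last five
columns of the right factor to be the forms of the first five, so its rows lie in the outer cone.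
Rigidity then exhibits `t` as a ratio of two entries in `F`. -/
theorem not_sum_five {t s : ℝ} (hs : 0 < s) (hst : s < 1 / 2) (ht : 1 / 2 < t) {F : Subfield ℝ}
    (htF : t ∉ F) : ¬ IsNonnegRankOneSum F (slackMatrix (t + s) (t * s)) 5 := by
  intro h
  obtain ⟨c, b, hc, hb, h⟩ := exists_factorization h
  have hm := factor_mul h
  set C : Matrix (Fin 5) (Fin 5) ℝ := Matrix.of fun r l => c l (Fin.succ r) with hC
  set w : Fin 5 → Fin 5 → ℝ := fun l i => b l (Fin.castAdd 5 i) with hw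
  have hdet : C.det ≠ 0 := by
    have hu := Matrix.linearIndependent_rows_iff_isUnit.1
      (show LinearIndependent ℝ (Matrix.of (cycPt (t + s) (t * s))).row from
        cycPt_linearIndependent (by linarith) hs)
    rw [hm, Matrix.isUnit_iff_isUnit_det, Matrix.det_mul] at hu
    exact (left_ne_zero_of_mul hu.ne_zero)
  have hrow : ∀ r, innerPt (t + s) (t * s) r = ∑ l, c l r • w l := by
    intro r
    funext i
    have := h r (Fin.castAdd 5 i)
    simpa [slackMatrix, slack] using this
  have hcol : ∀ l i, b l (Fin.natAdd 5 i) = cycForm i (w l) := by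
    intro l i
    have : C.mulVec (fun l => b l (Fin.natAdd 5 i) - cycForm i (w l)) = 0 := by
      funext r
      have h1 := h r.succ (Fin.natAdd 5 i)
      have h2 := congrFun (slack_sum Finset.univ (fun l => c l r.succ) w) (Fin.natAdd 5 i)
      rw [← hrow] at h2
      have h3 : ∑ l, c l r.succ * b l (Fin.natAdd 5 i) = ∑ l, c l r.succ * cycForm i (w l) := by
        rw [← h1]
        simpa only [slackMatrix, Matrix.of_apply, Finset.sum_apply, Pi.smul_apply, smul_eq_mul,
          slack_natAdd] using h2
      simp only [Matrix.mulVec, dotProduct, mul_sub, Finset.sum_sub_distrib, hC, Matrix.of_apply,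
        Pi.zero_apply, h3, sub_self]
    have := congrFun (Matrix.eq_zero_of_mulVec_eq_zero hdet this) l
    simpa [sub_eq_zero] using this
  obtain ⟨σ, -, hσ⟩ := cone_rigidity (w := w) hs hst ht (by simp) (fun l i => (hb l _).2)
    (fun l i => by rw [← hcol]; exact (hb l _).2)
    (fun k => ⟨fun l => c l k.succ, fun l => hc l _, by simpa [innerPt] using (hrow k.succ).symm⟩)
    ⟨fun l => c l 0, fun l => hc l _, by simpa [innerPt] using (hrow 0).symm⟩
  obtain ⟨a, ha, hv⟩ := hσ 0
  have h0 : w (σ 0) 0 = a := by rw [hv]; simp [cycVec]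
  have h1 : w (σ 0) 1 = a * t := by rw [hv]; simp [cycVec]
  have m0 : w (σ 0) 0 ∈ F := (hb _ _).1
  have m1 : w (σ 0) 1 ∈ F := (hb _ _).1
  apply htF
  have : t = w (σ 0) 1 / w (σ 0) 0 := by rw [h0, h1]; field_simp
  rw [this]
  exact F.div_mem m1 m0

theorem sum_five {t s : ℝ} (h0 : 1 / 2 < t) (h1 : t < 1) (hs : 1 / 8 ≤ s) :
    IsNonnegRankOneSum ⊤ (slackMatrix (t + s) (t * s)) 5 := by
  refine ⟨fun k => Matrix.vecMulVec (fun r => innerCoeff t s r k) (slack (cycVec t k)),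
    fun k => ⟨?_, fun i j => ⟨trivial, ?_⟩⟩, ?_⟩
  · refine le_antisymm (Matrix.rank_vecMulVec_le _ _) (Nat.one_le_iff_ne_zero.2 fun h => ?_)
    have h' := Submodule.finrank_eq_zero.1 h
    rw [LinearMap.range_eq_bot] at h'
    have := congrFun (LinearMap.congr_fun h' (Pi.single (Fin.castAdd 5 k) 1)) k.succ
    simp [Matrix.vecMulVec_apply, innerCoeff, slack, cycVec] at this
  · exact mul_nonneg (innerCoeff_nonneg (by linarith) hs _ k)
      (slack_nonneg (cycVec_nonneg (by linarith) k) (cycForm_cycVec_nonneg h0.le h1.le k) j)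
  · ext r j
    rw [slackMatrix_eq, Matrix.sum_apply]
    rfl

theorem nonnegRank_slackMatrix {t s : ℝ} (h0 : 1 / 2 < t) (h1 : t < 1) (hs : 1 / 8 ≤ s) :
    nonnegRank ⊤ (slackMatrix (t + s) (t * s)) = 5 :=
  le_antisymm (Nat.sInf_le (sum_five h0 h1 hs))
    (le_csInf ⟨5, sum_five h0 h1 hs⟩ fun _ hk =>
      five_le_of_sum (by linarith) (by linarith) hk)

theorem nonnegRank_slackMatrix_ne {t s : ℝ} (h0 : 1 / 2 < t) (hs : 0 < s) (hst : s < 1 / 2)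
    {F : Subfield ℝ} (htF : t ∉ F) : nonnegRank F (slackMatrix (t + s) (t * s)) ≠ 5 := by
  intro h
  -- The infimum of the empty set is `0`, so the value `5` is attained.
  have hne : {k | IsNonnegRankOneSum F (slackMatrix (t + s) (t * s)) k}.Nonempty :=
    Nat.nonempty_of_pos_sInf (by unfold nonnegRank at h; omega)
  have := Nat.sInf_mem hne
  unfold nonnegRank at h
  rw [h] at this
  exact not_sum_five hs hst h0 htF this

/-! ### The polytopes -/

theorem exists_weights_of_mem_convexHull {ι E : Type*} [Fintype ι] [AddCommGroup E] [Module ℝ E]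
    {z : ι → E} {y : E} (hy : y ∈ convexHull ℝ (Set.range z)) :
    ∃ d : ι → ℝ, (∀ j, 0 ≤ d j) ∧ ∑ j, d j = 1 ∧ ∑ j, d j • z j = y := by
  classical
  have hlin : IsLinearMap ℝ fun d : ι → ℝ => ∑ j, d j • z j :=
    ⟨fun a b => by simp [add_smul, Finset.sum_add_distrib],
      fun c a => by simp [mul_smul, Finset.smul_sum]⟩
  have hsub : convexHull ℝ (Set.range z) ⊆ (fun d : ι → ℝ => ∑ j, d j • z j) '' stdSimplex ℝ ι := by
    refine convexHull_min ?_ ((convex_stdSimplex ℝ ι).is_linear_image hlin)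
    rintro _ ⟨j, rfl⟩
    exact ⟨Pi.single j 1, single_mem_stdSimplex ℝ j, by simp [Pi.single_apply]⟩
  obtain ⟨d, hd, rfl⟩ := hsub hy
  exact ⟨d, hd.1, hd.2, rfl⟩

theorem mem_extremePoints_of_linearIndependent {ι E : Type*} [Fintype ι] [AddCommGroup E]
    [Module ℝ E] {z : ι → E} (hz : LinearIndependent ℝ z) (i : ι) :
    z i ∈ (convexHull ℝ (Set.range z)).extremePoints ℝ := by
  classical
  refine ⟨subset_convexHull ℝ _ ⟨i, rfl⟩, ?_⟩
  rintro x hx y hy ⟨a, b, ha, hb, -, hab⟩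
  obtain ⟨c, hc, hc1, rfl⟩ := exists_weights_of_mem_convexHull hx
  obtain ⟨d, hd, -, rfl⟩ := exists_weights_of_mem_convexHull hy
  have key := Fintype.linearIndependent_iff.1 hz
    (fun j => a * c j + b * d j - (Pi.single i 1 : ι → ℝ) j) (by
      simp only [sub_smul, add_smul, Finset.sum_sub_distrib, Finset.sum_add_distrib, mul_smul,
        ← Finset.smul_sum, hab]
      simp [Pi.single_apply])
  have hzero : ∀ j, j ≠ i → c j = 0 := by
    intro j hj
    have := key j
    rw [Pi.single_eq_of_ne hj, sub_zero] at this
    have h1 : 0 ≤ a * c j := mul_nonneg ha.le (hc j)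
    have h2 : 0 ≤ b * d j := mul_nonneg hb.le (hd j)
    exact (mul_eq_zero.1 (by linarith : a * c j = 0)).resolve_left ha.ne'
  rw [Finset.sum_eq_single i (fun j _ hj => hzero j hj) (by simp)] at hc1
  rw [Finset.sum_eq_single i (fun j _ hj => by rw [hzero j hj, zero_smul]) (by simp), hc1, one_smul]

/-- The sum of the coordinates. -/
def coordSum : (Fin 5 → ℝ) →ₗ[ℝ] ℝ := ∑ i, LinearMap.proj i

theorem coordSum_apply (x : Fin 5 → ℝ) : coordSum x = ∑ i, x i := by
  simp [coordSum]

theorem vectorSpan_le_ker {S : Set (Fin 5 → ℝ)} (hS : S ⊆ sumOne) :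
    vectorSpan ℝ S ≤ LinearMap.ker coordSum := by
  refine Submodule.span_le.2 ?_
  rintro _ ⟨x, hx, y, hy, rfl⟩
  have hx' : ∑ i, x i = 1 := hS hx
  have hy' : ∑ i, y i = 1 := hS hy
  simp [coordSum_apply, hx', hy']

theorem finrank_vectorSpan_le {S : Set (Fin 5 → ℝ)} (hS : S ⊆ sumOne) :
    Module.finrank ℝ (vectorSpan ℝ S) ≤ 4 := by
  refine (Submodule.finrank_mono (vectorSpan_le_ker hS)).trans ?_
  have h : LinearMap.ker coordSum ≠ ⊤ := by
    intro h
    have h1 : (Pi.single 0 1 : Fin 5 → ℝ) ∈ LinearMap.ker coordSum := h ▸ Submodule.mem_top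
    rw [LinearMap.mem_ker, coordSum_apply] at h1
    simp at h1
  have := Submodule.finrank_lt h
  simp only [Module.finrank_fintype_fun_eq_card, Fintype.card_fin] at this
  omega

theorem polyDim_eq_four {S : Set (Fin 5 → ℝ)} (hS : S ⊆ sumOne) {z : Fin 5 → Fin 5 → ℝ}
    (hz : LinearIndependent ℝ z) (hzS : ∀ k, z k ∈ S) : polyDim S = 4 := by
  refine le_antisymm (finrank_vectorSpan_le hS) ?_
  rw [← hz.affineIndependent.finrank_vectorSpan (show Fintype.card (Fin 5) = 4 + 1 by simp)]
  exact Submodule.finrank_mono (vectorSpan_mono ℝ (by rintro _ ⟨k, rfl⟩; exact hzS k))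

/-- The coordinate change that takes the line through the first two basis vectors to the line of
the points `Omega`. -/
def amb : (Fin 5 → ℝ) ≃ₗ[ℝ] (Fin 5 → ℝ) where
  toFun x := ![x 0 / 2 + x 1 + x 2, 2 * x 1, x 0 / 2 + x 1 + x 3, x 0, x 4]
  invFun y := ![y 3, y 1 / 2, y 0 - y 3 / 2 - y 1 / 2, y 2 - y 3 / 2 - y 1 / 2, y 4]
  map_add' x y := by
    funext i; fin_cases i <;> simp <;> ring
  map_smul' c x := by
    funext i; fin_cases i <;> simp <;> ring
  left_inv x := by
    funext i; fin_cases i <;> simp <;> ring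
  right_inv y := by
    funext i; fin_cases i <;> simp <;> ring

theorem amb_apply (x : Fin 5 → ℝ) :
    amb x = ![x 0 / 2 + x 1 + x 2, 2 * x 1, x 0 / 2 + x 1 + x 3, x 0, x 4] := rfl

theorem coordSum_amb (x : Fin 5 → ℝ) :
    coordSum (amb x) = 2 * x 0 + 4 * x 1 + x 2 + x 3 + x 4 := by
  rw [coordSum_apply, amb_apply, Fin.sum_univ_five]
  simp
  ring

/-- The multiple of `amb x` with coordinate sum `1`. -/
def ambPt (x : Fin 5 → ℝ) : Fin 5 → ℝ := (coordSum (amb x))⁻¹ • amb x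

theorem ambPt_mem_sumOne {x : Fin 5 → ℝ} (h : 0 < coordSum (amb x)) : ambPt x ∈ sumOne := by
  change ∑ i, ambPt x i = 1
  rw [← coordSum_apply, ambPt, map_smul, smul_eq_mul, inv_mul_cancel₀ h.ne']

theorem ambPt_coord_mem {F : Subfield ℝ} {x : Fin 5 → ℝ} (h : ∀ i, x i ∈ F) (i : Fin 5) :
    ambPt x i ∈ F := by
  have h2 : (2 : ℝ) ∈ F := by exact_mod_cast natCast_mem F 2
  have key : ∀ i, amb x i ∈ F := by
    intro i
    rw [amb_apply]
    fin_cases i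
    · exact F.add_mem (F.add_mem (F.div_mem (h 0) h2) (h 1)) (h 2)
    · exact F.mul_mem h2 (h 1)
    · exact F.add_mem (F.add_mem (F.div_mem (h 0) h2) (h 1)) (h 3)
    · exact h 0
    · exact h 4
  rw [ambPt, coordSum_apply]
  exact F.mul_mem (F.inv_mem (sum_mem fun i _ => key i)) (key i)

theorem ambPt_smul {c : ℝ} (hc : c ≠ 0) (x : Fin 5 → ℝ) : ambPt (c • x) = ambPt x := by
  simp only [ambPt, map_smul, smul_eq_mul, mul_inv, smul_smul]
  congr 1
  field_simp

theorem ambPt_symm {y : Fin 5 → ℝ} (hy : y ∈ sumOne) : ambPt (amb.symm y) = y := by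
  have : ∑ i, y i = 1 := hy
  simp [ambPt, coordSum_apply, this]

theorem ambPt_linearIndependent {z : Fin 5 → Fin 5 → ℝ} (hz : LinearIndependent ℝ z)
    (h : ∀ k, 0 < coordSum (amb (z k))) : LinearIndependent ℝ fun k => ambPt (z k) :=
  (hz.map' amb.toLinearMap (LinearEquiv.ker amb)).units_smul
    fun k => Units.mk0 _ (inv_ne_zero (h k).ne')

theorem ambPt_mem_convexHull {ι : Type*} [Fintype ι] {w : ι → Fin 5 → ℝ} {y : Fin 5 → ℝ}
    (h : InCone w y) (hw : ∀ j, 0 < coordSum (amb (w j))) (hy : 0 < coordSum (amb y)) :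
    ambPt y ∈ convexHull ℝ (Set.range fun j => ambPt (w j)) := by
  obtain ⟨d, hd, rfl⟩ := h
  set S := coordSum (amb (∑ j, d j • w j)) with hS
  refine mem_convexHull_of_exists_fintype (fun j => S⁻¹ * (d j * coordSum (amb (w j))))
    (fun j => ambPt (w j)) (fun j => ?_) ?_ (fun j => ⟨j, rfl⟩) ?_
  · exact mul_nonneg (inv_nonneg.2 hy.le) (mul_nonneg (hd j) (hw j).le)
  · rw [← Finset.mul_sum, inv_mul_eq_one₀ hy.ne', hS]
    simp
  · rw [ambPt, ← hS, map_sum, Finset.smul_sum]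
    refine Finset.sum_congr rfl fun j _ => ?_
    rw [ambPt, smul_smul, map_smul, smul_smul]
    congr 1
    have := (hw j).ne'
    field_simp

theorem inCone_of_mem_convexHull {ι : Type*} [Fintype ι] {z : ι → Fin 5 → ℝ} {y : Fin 5 → ℝ}
    (hy : 0 < coordSum (amb y)) (h : ambPt y ∈ convexHull ℝ (Set.range z)) :
    InCone (fun j => amb.symm (z j)) y := by
  obtain ⟨d, hd, -, hdy⟩ := exists_weights_of_mem_convexHull h
  refine ⟨fun j => coordSum (amb y) * d j, fun j => mul_nonneg hy.le (hd j), ?_⟩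
  simp only [mul_smul, ← Finset.smul_sum, ← map_smul, ← map_sum, hdy]
  rw [ambPt, smul_smul, mul_inv_cancel₀ hy.ne', one_smul, LinearEquiv.symm_apply_apply]

theorem coordSum_cycVec_pos {t : ℝ} (ht : 0 < t) (k : Fin 5) : 0 < coordSum (amb (cycVec t k)) := by
  rw [coordSum_amb]
  unfold cycVec
  fin_cases k <;> simp <;> linarith

theorem coordSum_pos_of_inCone {ι : Type*} [Fintype ι] {w : ι → Fin 5 → ℝ} {y : Fin 5 → ℝ}
    (h : InCone w y) (hy : y ≠ 0) (hw : ∀ j, 0 < coordSum (amb (w j))) :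
    0 < coordSum (amb y) := by
  obtain ⟨d, hd, rfl⟩ := h
  simp only [map_sum, map_smul, smul_eq_mul]
  have hn : ∀ j ∈ Finset.univ, 0 ≤ d j * coordSum (amb (w j)) := fun j _ =>
    mul_nonneg (hd j) (hw j).le
  refine (Finset.sum_nonneg hn).lt_of_ne' fun h0 => hy ?_
  rw [Finset.sum_eq_zero_iff_of_nonneg hn] at h0
  refine Finset.sum_eq_zero fun j hj => ?_
  rw [(mul_eq_zero.1 (h0 j hj)).resolve_right (hw j).ne', zero_smul]

/-! ### The nested polytopes and the simplex between them -/

theorem innerPt_inCone {t s : ℝ} (ht : 0 < t) (hs : 1 / 8 ≤ s) (r : Fin 6) :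
    InCone (cycVec t) (innerPt (t + s) (t * s) r) :=
  ⟨innerCoeff t s r, innerCoeff_nonneg ht hs r, (innerPt_eq t s r).symm⟩

theorem coordSum_innerPt_pos {t s : ℝ} (ht : 0 < t) (hs : 1 / 8 ≤ s) (r : Fin 6) :
    0 < coordSum (amb (innerPt (t + s) (t * s) r)) := by
  refine coordSum_pos_of_inCone (innerPt_inCone ht hs r) ?_ (coordSum_cycVec_pos ht)
  intro h
  induction r using Fin.cases with
  | zero =>
    have := congrFun h 0
    simp [innerPt, outerPt, cycPt] at this
  | succ k =>
    have := congrFun h k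
    simp [innerPt, cycPt] at this

/-- The vertices of the outer polytope, before normalization. -/
def outerVertex : Fin 5 ⊕ Fin 5 → Fin 5 → ℝ := Sum.elim (cycVec (1 / 2)) (cycVec 1)

theorem coordSum_outerVertex_pos (j : Fin 5 ⊕ Fin 5) : 0 < coordSum (amb (outerVertex j)) := by
  rcases j with j | j
  · exact coordSum_cycVec_pos (by norm_num) j
  · exact coordSum_cycVec_pos (by norm_num) j

theorem cycVec_inCone_outerVertex {t : ℝ} (h0 : 1 / 2 < t) (h1 : t < 1) (k : Fin 5) :
    InCone outerVertex (cycVec t k) := by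
  refine ⟨Sum.elim (Pi.single k (2 - 2 * t)) (Pi.single k (2 * t - 1)), ?_, ?_⟩
  · rintro (j | j)
    · by_cases h : j = k
      · subst h; simp; linarith
      · simp [h]
    · by_cases h : j = k
      · subst h; simp; linarith
      · simp [h]
  · simp only [Fintype.sum_sum_type, outerVertex, Sum.elim_inl, Sum.elim_inr]
    rw [Finset.sum_eq_single k (fun j _ hj => by simp [hj]) (by simp),
      Finset.sum_eq_single k (fun j _ hj => by simp [hj]) (by simp)]
    funext i
    simp only [Pi.single_eq_same, Pi.add_apply, Pi.smul_apply, cycVec, smul_eq_mul]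
    split_ifs <;> ring

/-- The inner polytope. -/
def innerPoly (b g : ℝ) : Set (Fin 5 → ℝ) :=
  convexHull ℝ (Set.range fun r => ambPt (innerPt b g r))

/-- The outer polytope. -/
def outerPoly : Set (Fin 5 → ℝ) := convexHull ℝ (Set.range fun j => ambPt (outerVertex j))

/-- The simplex between the two polytopes. -/
def midSimplex (t : ℝ) : Set (Fin 5 → ℝ) := convexHull ℝ (Set.range fun k => ambPt (cycVec t k))

theorem innerPoly_subset {t s : ℝ} (ht : 0 < t) (hs : 1 / 8 ≤ s) :
    innerPoly (t + s) (t * s) ⊆ midSimplex t := by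
  refine convexHull_min ?_ (convex_convexHull ℝ _)
  rintro _ ⟨r, rfl⟩
  exact ambPt_mem_convexHull (innerPt_inCone ht hs r) (coordSum_cycVec_pos ht)
    (coordSum_innerPt_pos ht hs r)

theorem midSimplex_subset {t : ℝ} (h0 : 1 / 2 < t) (h1 : t < 1) : midSimplex t ⊆ outerPoly := by
  refine convexHull_min ?_ (convex_convexHull ℝ _)
  rintro _ ⟨k, rfl⟩
  exact ambPt_mem_convexHull (cycVec_inCone_outerVertex h0 h1 k) coordSum_outerVertex_pos
    (coordSum_cycVec_pos (by linarith) k)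

theorem outerPoly_subset_sumOne : outerPoly ⊆ sumOne := by
  refine convexHull_min ?_ ?_
  · rintro _ ⟨j, rfl⟩
    exact ambPt_mem_sumOne (coordSum_outerVertex_pos j)
  · have : sumOne = {x | coordSum x = 1} := by
      ext x
      simp [sumOne, coordSum_apply]
    rw [this]
    exact convex_hyperplane coordSum.isLinear 1

theorem slack_nonneg_of_mem_outerPoly {y : Fin 5 → ℝ} (hy : y ∈ outerPoly) (j : Fin (5 + 5)) :
    0 ≤ slack (amb.symm y) j := by
  obtain ⟨d, hd, -, rfl⟩ := exists_weights_of_mem_convexHull hy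
  have h : ∀ l, 0 ≤ slack (outerVertex l) j := by
    rintro (l | l)
    · exact slack_nonneg (cycVec_nonneg (by norm_num) l)
        (cycForm_cycVec_nonneg (by norm_num) (by norm_num) l) j
    · exact slack_nonneg (cycVec_nonneg (by norm_num) l)
        (cycForm_cycVec_nonneg (by norm_num) (by norm_num) l) j
  simp only [map_sum, map_smul, ambPt, LinearEquiv.symm_apply_apply, smul_smul, slack_sum,
    Finset.sum_apply, Pi.smul_apply, smul_eq_mul]
  exact Finset.sum_nonneg fun l _ => mul_nonneg
    (mul_nonneg (hd l) (inv_nonneg.2 (coordSum_outerVertex_pos l).le)) (h l)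

theorem midSimplex_isSimplex {t : ℝ} (ht : 0 < t) : IsSimplex (midSimplex t) :=
  ⟨4, ⟨fun k => ambPt (cycVec t k), (ambPt_linearIndependent (cycVec_linearIndependent ht)
    (coordSum_cycVec_pos ht)).affineIndependent⟩, rfl⟩

theorem eq_midSimplex {t s : ℝ} (h0 : 1 / 2 < t) (hs : 1 / 8 ≤ s) (hst : s < 1 / 2)
    {D : Set (Fin 5 → ℝ)} (hD : IsSimplex D) (hPD : innerPoly (t + s) (t * s) ⊆ D)
    (hDQ : D ⊆ outerPoly) : D = midSimplex t := by
  have ht : 0 < t := by linarith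
  obtain ⟨n, z, rfl⟩ := hD
  have hzQ : ∀ j, z.points j ∈ outerPoly := fun j => hDQ (subset_convexHull ℝ _ ⟨j, rfl⟩)
  have hz1 : ∀ j, z.points j ∈ sumOne := fun j => outerPoly_subset_sumOne (hzQ j)
  -- The simplex lies in a hyperplane of dimension four, hence has at most the five vertices that
  -- rigidity allows.
  have hn : n ≤ 4 := by
    rw [← z.independent.finrank_vectorSpan (Fintype.card_fin _)]
    exact finrank_vectorSpan_le (by rintro _ ⟨j, rfl⟩; exact hz1 j)
  have hcone : ∀ r, InCone (fun j => amb.symm (z.points j)) (innerPt (t + s) (t * s) r) := fun r =>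
    inCone_of_mem_convexHull (coordSum_innerPt_pos ht hs r) (hPD (subset_convexHull ℝ _ ⟨r, rfl⟩))
  obtain ⟨σ, hσ, hv⟩ := cone_rigidity (w := fun j => amb.symm (z.points j)) (t := t) (s := s)
    (by linarith) hst h0 (by simpa using Nat.lt_succ_of_le hn)
    (fun j i => by
      simpa only [slack_castAdd] using slack_nonneg_of_mem_outerPoly (hzQ j) (Fin.castAdd 5 i))
    (fun j i => by
      simpa only [slack_natAdd] using slack_nonneg_of_mem_outerPoly (hzQ j) (Fin.natAdd 5 i))
    (fun k => by simpa [innerPt] using hcone k.succ) (by simpa [innerPt] using hcone 0)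
  have hpt : ∀ k, z.points (σ k) = ambPt (cycVec t k) := by
    intro k
    obtain ⟨c, hc, h⟩ := hv k
    rw [← ambPt_symm (hz1 (σ k))]
    rw [h, ambPt_smul hc.ne']
  rw [midSimplex, ← hσ.2.range_comp z.points]
  congr 2
  funext k
  exact hpt k

theorem ambPt_cycVec_eq_Omega (τ : ℝ) : ambPt (cycVec (τ + 1 / 2) 0) = Omega τ := by
  rw [ambPt, coordSum_amb, amb_apply, Omega]
  congr 1
  · simp [cycVec]; ring
  · funext i
    fin_cases i <;> simp [cycVec] <;> ring

theorem cycVec_mem {F : Subfield ℝ} {t : ℝ} (ht : t ∈ F) (k i : Fin 5) : cycVec t k i ∈ F := by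
  unfold cycVec
  split_ifs
  exacts [F.one_mem, ht, F.zero_mem]

theorem verticesIn_innerPoly {F : Subfield ℝ} {b g : ℝ} (hb : b ∈ F) (hg : g ∈ F) :
    VerticesIn F (innerPoly b g) := by
  intro v hv
  obtain ⟨r, rfl⟩ := extremePoints_convexHull_subset hv
  exact ambPt_coord_mem (innerPt_mem hb hg r)

theorem verticesIn_outerPoly (F : Subfield ℝ) : VerticesIn F outerPoly := by
  intro v hv
  obtain ⟨j, rfl⟩ := extremePoints_convexHull_subset hv
  have h2 : (1 / 2 : ℝ) ∈ F := F.div_mem F.one_mem (by exact_mod_cast natCast_mem F 2)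
  refine ambPt_coord_mem ?_
  rcases j with j | j
  · exact cycVec_mem h2 j
  · exact cycVec_mem F.one_mem j

theorem Omega_three_notMem {F : Subfield ℝ} {τ : ℝ} (h : τ ∉ F) :
    Omega τ 3 ∉ F := by
  intro hm
  have h4 : (4 : ℝ) ∈ F := by exact_mod_cast natCast_mem F 4
  have e : Omega τ 3 = (4 + 4 * τ)⁻¹ := by simp [Omega]
  rw [e] at hm
  have := F.sub_mem (F.div_mem (F.inv_mem hm) h4) F.one_mem
  rw [inv_inv] at this
  apply h
  convert this using 1
  ring

theorem shift_mem {F : Subfield ℝ} {τ τ' : ℝ} (hadd : τ + τ' ∈ F) (hmul : τ * τ' ∈ F) :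
    τ + 1 / 2 + (τ' + 1 / 2) ∈ F ∧ (τ + 1 / 2) * (τ' + 1 / 2) ∈ F := by
  have h2 : (2 : ℝ) ∈ F := by exact_mod_cast natCast_mem F 2
  constructor
  · convert F.add_mem hadd F.one_mem using 1
    ring
  · convert F.add_mem hmul (F.add_mem (F.div_mem hadd h2)
      (F.mul_mem (F.inv_mem h2) (F.inv_mem h2))) using 1
    ring

/-- Every real number `τ ∈ (0, 1/2)` that is quadratic over a field `F` and whose conjugate lies in
`[-3/8, 0)` occurs in the unique simplex between two polytopes over `F`. -/
theorem exists_polytopes {F : Subfield ℝ} {τ τ' : ℝ} (h0 : 0 < τ) (h1 : τ < 1 / 2)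
    (h0' : -(3 / 8) ≤ τ') (h1' : τ' < 0) (hadd : τ + τ' ∈ F) (hmul : τ * τ' ∈ F) (hτ : τ ∉ F) :
    ∃ P Q : Set (Fin 5 → ℝ), IsPolytope P ∧ IsPolytope Q ∧ P ⊆ Q ∧ Q ⊆ sumOne ∧
      polyDim P = 4 ∧ polyDim Q = 4 ∧ VerticesIn F P ∧ VerticesIn F Q ∧
      ∃ Δ : Set (Fin 5 → ℝ), (IsSimplex Δ ∧ P ⊆ Δ ∧ Δ ⊆ Q) ∧
        (∀ Δ' : Set (Fin 5 → ℝ), IsSimplex Δ' → P ⊆ Δ' → Δ' ⊆ Q → Δ' = Δ) ∧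
        Omega τ ∈ Δ.extremePoints ℝ ∧ ∃ i, Omega τ i ∉ F := by
  set t := τ + 1 / 2 with ht
  set s := τ' + 1 / 2 with hs
  have ht0 : 1 / 2 < t := by linarith
  have ht1 : t < 1 := by linarith
  have hs0 : 1 / 8 ≤ s := by linarith
  have hs1 : s < 1 / 2 := by linarith
  obtain ⟨hb, hg⟩ := shift_mem hadd hmul
  have hPD := innerPoly_subset (by linarith : 0 < t) hs0
  have hDQ := midSimplex_subset ht0 ht1
  have hPQ := hPD.trans hDQ
  have hli := ambPt_linearIndependent
    (cycPt_linearIndependent (by linarith : 0 < t) (by linarith : 0 < s)) fun k => by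
      simpa [innerPt] using coordSum_innerPt_pos (by linarith : 0 < t) hs0 k.succ
  have hmem : ∀ k, ambPt (cycPt (t + s) (t * s) k) ∈ innerPoly (t + s) (t * s) := fun k =>
    subset_convexHull ℝ _ ⟨k.succ, by simp [innerPt]⟩
  refine ⟨innerPoly (t + s) (t * s), outerPoly, ⟨_, Set.finite_range _, rfl⟩,
    ⟨_, Set.finite_range _, rfl⟩, hPQ, outerPoly_subset_sumOne,
    polyDim_eq_four (hPQ.trans outerPoly_subset_sumOne) hli hmem,
    polyDim_eq_four outerPoly_subset_sumOne hli (fun k => hPQ (hmem k)),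
    verticesIn_innerPoly hb hg, verticesIn_outerPoly F, midSimplex t,
    ⟨midSimplex_isSimplex (by linarith), hPD, hDQ⟩,
    fun D hD hP hQ => eq_midSimplex ht0 hs0 hs1 hD hP hQ, ?_, 3, Omega_three_notMem hτ⟩
  rw [← ambPt_cycVec_eq_Omega]
  exact mem_extremePoints_of_linearIndependent (ambPt_linearIndependent
    (cycVec_linearIndependent (by linarith : 0 < t)) (coordSum_cycVec_pos (by linarith))) 0

/-- Under the same assumptions there is a matrix whose nonnegative rank depends on the field. -/
theorem exists_matrix {F : Subfield ℝ} {τ τ' : ℝ} (h0 : 0 < τ) (h1 : τ < 1 / 2)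
    (h0' : -(3 / 8) ≤ τ') (h1' : τ' < 0) (hadd : τ + τ' ∈ F) (hmul : τ * τ' ∈ F) (hτ : τ ∉ F) :
    ∃ (m n : ℕ) (A : Matrix (Fin m) (Fin n) ℝ), (∀ i j, A i j ∈ F ∧ 0 ≤ A i j) ∧
      nonnegRank ⊤ A = 5 ∧ nonnegRank F A ≠ nonnegRank ⊤ A := by
  set t := τ + 1 / 2 with ht
  set s := τ' + 1 / 2 with hs
  have ht0 : 1 / 2 < t := by linarith
  have ht1 : t < 1 := by linarith
  have hs0 : 1 / 8 ≤ s := by linarith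
  have hs1 : s < 1 / 2 := by linarith
  obtain ⟨hb, hg⟩ := shift_mem hadd hmul
  have htF : t ∉ F := fun h => hτ (by
    have h2 : (2 : ℝ) ∈ F := by exact_mod_cast natCast_mem F 2
    convert F.sub_mem h (F.inv_mem h2) using 1
    rw [ht]; ring)
  have h5 := nonnegRank_slackMatrix ht0 ht1 hs0
  refine ⟨6, 5 + 5, slackMatrix (t + s) (t * s), fun i j =>
    ⟨slackMatrix_mem hb hg i j, slackMatrix_nonneg ht0 ht1 hs0 i j⟩, h5, ?_⟩
  rw [h5]
  exact nonnegRank_slackMatrix_ne ht0 (by linarith) hs1 htF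

/-! ### Integer polynomials as lists of coefficients -/

/-- The polynomial with the given coefficients, constant term first. -/
def ofList : List ℤ → ℤ[X]
  | [] => 0
  | c :: L => C c + X * ofList L

/-- Coefficientwise sum. -/
def addL : List ℤ → List ℤ → List ℤ
  | [], M => M
  | a :: L, [] => a :: L
  | a :: L, b :: M => (a + b) :: addL L M

/-- Multiplication by a constant. -/
def smulL (c : ℤ) (L : List ℤ) : List ℤ := L.map (c * ·)

/-- Product of polynomials. -/
def mulL : List ℤ → List ℤ → List ℤ
  | [], _ => []
  | a :: L, M => addL (smulL a M) (0 :: mulL L M)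

/-- Long division, all coefficients listed from the leading one on. -/
def quoL (h : ℤ) (H : List ℤ) : ℕ → List ℤ → List ℤ
  | n + 1, c :: L => c / h :: quoL h H n (addL L (smulL (-(c / h)) H))
  | _, _ => []

/-- The quotient by the polynomial `H`, provided that `H` divides `L` over the integers. -/
def divL (H L : List ℤ) : List ℤ :=
  (quoL (H.reverse.headD 1) H.reverse.tail (L.length + 1 - H.length) L.reverse).reverse

theorem ofList_addL (L M : List ℤ) : ofList (addL L M) = ofList L + ofList M := by
  induction L generalizing M with
  | nil => simp [addL, ofList]
  | cons a L ih =>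
    cases M with
    | nil => simp [addL, ofList]
    | cons b M => simp only [addL, ofList, ih, map_add]; ring

theorem ofList_smulL (c : ℤ) (L : List ℤ) : ofList (smulL c L) = C c * ofList L := by
  induction L with
  | nil => simp [smulL, ofList]
  | cons a L ih =>
    simp only [smulL, List.map_cons, ofList, map_mul] at ih ⊢
    rw [ih]; ring

theorem ofList_mulL (L M : List ℤ) : ofList (mulL L M) = ofList L * ofList M := by
  induction L with
  | nil => simp [mulL, ofList]
  | cons a L ih => simp only [mulL, ofList_addL, ofList_smulL, ofList, ih, map_zero]; ring

theorem ofList_eq_zero {L : List ℤ} (h : ∀ c ∈ L, c = 0) : ofList L = 0 := by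
  induction L with
  | nil => rfl
  | cons a L ih =>
    rw [ofList, ih fun c hc => h c (List.mem_cons_of_mem _ hc), h a List.mem_cons_self]
    simp

/-- The quotient serves only as a certificate: the division algorithm needs no correctness proof,
since the product is compared with `L`. -/
theorem ofList_dvd {H L : List ℤ} (h : ∀ c ∈ addL L (smulL (-1) (mulL H (divL H L))), c = 0) :
    ofList H ∣ ofList L := by
  have := ofList_eq_zero h
  rw [ofList_addL, ofList_smulL, ofList_mulL] at this
  exact ⟨ofList (divL H L), by simpa [← sub_eq_add_neg, sub_eq_zero] using this⟩

theorem coeff_ofList (L : List ℤ) (n : ℕ) : (ofList L).coeff n = L.getD n 0 := by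
  induction L generalizing n with
  | nil => simp [ofList]
  | cons a L ih =>
    cases n with
    | zero => simp [ofList]
    | succ n => simp only [ofList, coeff_add, coeff_X_mul, ih, coeff_C_succ, zero_add,
        List.getD_cons_succ]

/-- The value at a real number. -/
def ev (L : List ℤ) (x : ℝ) : ℝ := aeval x (ofList L)

theorem ev_nil (x : ℝ) : ev [] x = 0 := by simp [ev, ofList]

theorem ev_cons (c : ℤ) (L : List ℤ) (x : ℝ) : ev (c :: L) x = c + x * ev L x := by
  simp [ev, ofList]

theorem ev_addL (L M : List ℤ) (x : ℝ) : ev (addL L M) x = ev L x + ev M x := by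
  simp [ev, ofList_addL]

theorem ev_smulL (c : ℤ) (L : List ℤ) (x : ℝ) : ev (smulL c L) x = c * ev L x := by
  simp [ev, ofList_smulL]

theorem ev_mulL (L M : List ℤ) (x : ℝ) : ev (mulL L M) x = ev L x * ev M x := by
  simp [ev, ofList_mulL]

theorem ev_eq_zero_of_dvd {H L : List ℤ} (h : ofList H ∣ ofList L) {x : ℝ} (hx : ev H x = 0) :
    ev L x = 0 := by
  obtain ⟨W, hW⟩ := h
  unfold ev at hx ⊢
  rw [hW, map_mul, hx, zero_mul]

theorem continuous_ev (L : List ℤ) : Continuous (ev L) := Polynomial.continuous_aeval _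

/-- Bounds for the value of a polynomial on `[a / S, b / S]`, multiplied by `S ^ L.length`. -/
def bounds (S a b : ℤ) : List ℤ → ℤ × ℤ
  | [] => (0, 0)
  | c :: L =>
    let r := bounds S a b L
    let k := c * S ^ (L.length + 1)
    (k + min (a * r.1) (b * r.1), k + max (a * r.2) (b * r.2))

/-- Horner's scheme in integer interval arithmetic. As `S * x` is nonnegative, the sign of the inner
bound decides which endpoint gives the extreme product. -/
theorem ev_mem_bounds {S a b : ℤ} (ha : 0 ≤ a) {x : ℝ} (h1 : (a : ℝ) ≤ S * x)
    (h2 : S * x ≤ b) (L : List ℤ) : ((bounds S a b L).1 : ℝ) ≤ (S : ℝ) ^ L.length * ev L x ∧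
      (S : ℝ) ^ L.length * ev L x ≤ (bounds S a b L).2 := by
  have ha' : (0 : ℝ) ≤ a := by exact_mod_cast ha
  have hx : 0 ≤ S * x := ha'.trans h1
  induction L with
  | nil => simp [bounds, ev_nil]
  | cons c L ih =>
    obtain ⟨i1, i2⟩ := ih
    set r := bounds S a b L with hr
    set y := (S : ℝ) ^ L.length * ev L x with hy
    have e : (S : ℝ) ^ (c :: L).length * ev (c :: L) x = c * (S : ℝ) ^ (L.length + 1) + S * x * y := by
      rw [ev_cons, List.length_cons, hy]
      ring
    rw [e]
    simp only [bounds, ← hr]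
    push_cast
    constructor
    · have : min ((a : ℝ) * r.1) (b * r.1) ≤ S * x * y := by
        rcases le_total 0 (r.1 : ℝ) with h | h
        · exact (min_le_left _ _).trans ((mul_le_mul_of_nonneg_right h1 h).trans
            (mul_le_mul_of_nonneg_left i1 hx))
        · exact (min_le_right _ _).trans ((mul_le_mul_of_nonpos_right h2 h).trans
            (mul_le_mul_of_nonneg_left i1 hx))
      linarith
    · have : S * x * y ≤ max ((a : ℝ) * r.2) (b * r.2) := by
        rcases le_total 0 (r.2 : ℝ) with h | h
        · exact ((mul_le_mul_of_nonneg_left i2 hx).trans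
            (mul_le_mul_of_nonneg_right h2 h)).trans (le_max_right _ _)
        · exact ((mul_le_mul_of_nonneg_left i2 hx).trans
            (mul_le_mul_of_nonpos_right h1 h)).trans (le_max_left _ _)
      linarith

section Sign

variable {S a b : ℤ} {x : ℝ}

theorem ev_pos (hS : 0 < S) (ha : 0 ≤ a) (h1 : (a : ℝ) ≤ S * x) (h2 : S * x ≤ b) (L : List ℤ)
    (h : 0 < (bounds S a b L).1) : 0 < ev L x := by
  have h' : (0 : ℝ) < (bounds S a b L).1 := by exact_mod_cast h
  exact pos_of_mul_pos_right (h'.trans_le (ev_mem_bounds ha h1 h2 L).1)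
    (pow_nonneg (by exact_mod_cast hS.le) _)

theorem ev_neg (hS : 0 < S) (ha : 0 ≤ a) (h1 : (a : ℝ) ≤ S * x) (h2 : S * x ≤ b) (L : List ℤ)
    (h : (bounds S a b L).2 < 0) : ev L x < 0 := by
  have h' : ((bounds S a b L).2 : ℝ) < 0 := by exact_mod_cast h
  by_contra hn
  push Not at hn
  have : 0 ≤ (S : ℝ) ^ L.length * ev L x :=
    mul_nonneg (pow_nonneg (by exact_mod_cast hS.le) _) hn
  linarith [(ev_mem_bounds ha h1 h2 L).2]

end Sign

/-- A sign change gives a root. -/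
theorem exists_root {S a b : ℤ} (hS : 0 < S) (ha : 0 ≤ a) (hab : a ≤ b) (L : List ℤ)
    (h : (0 < (bounds S a a L).1 ∧ (bounds S b b L).2 < 0) ∨
      ((bounds S a a L).2 < 0 ∧ 0 < (bounds S b b L).1)) :
    ∃ x : ℝ, ev L x = 0 ∧ (a : ℝ) ≤ S * x ∧ S * x ≤ b := by
  have hS' : (0 : ℝ) < S := by exact_mod_cast hS
  have hab' : (a : ℝ) / S ≤ b / S := by
    have : (a : ℝ) ≤ b := by exact_mod_cast hab
    gcongr
  have ea : (S : ℝ) * (a / S) = a := by field_simp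
  have eb : (S : ℝ) * (b / S) = b := by field_simp
  have key : (0 : ℝ) ∈ ev L '' Set.Icc (a / S : ℝ) (b / S) := by
    rcases h with ⟨h1, h2⟩ | ⟨h1, h2⟩
    · exact intermediate_value_Icc' hab' (continuous_ev L).continuousOn
        ⟨(ev_neg hS (ha.trans hab) eb.ge eb.le L h2).le, (ev_pos hS ha ea.ge ea.le L h1).le⟩
    · exact intermediate_value_Icc hab' (continuous_ev L).continuousOn
        ⟨(ev_neg hS ha ea.ge ea.le L h1).le, (ev_pos hS (ha.trans hab) eb.ge eb.le L h2).le⟩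
  obtain ⟨x, ⟨h1, h2⟩, hx⟩ := key
  refine ⟨x, hx, ?_, ?_⟩
  · rw [← ea]; gcongr
  · rw [← eb]; gcongr

/-! ### Irreducibility from a prime value -/

/-- Lucas's criterion. Listing the primes with multiplicity lets the product certify that no prime
factor of `p - 1` is missing. -/
theorem prime_of_factors {p : ℕ} (a : ZMod p) (L : List ℕ) (hL : ∀ q ∈ L, q.Prime)
    (hp : L.prod = p - 1) (h1 : a ^ (p - 1) = 1) (h2 : ∀ q ∈ L, a ^ ((p - 1) / q) ≠ 1) :
    p.Prime := by
  refine lucas_primality p a h1 fun q hq hd => h2 q ?_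
  rw [← hp, hq.prime.dvd_prod_iff] at hd
  obtain ⟨r, hr, hqr⟩ := hd
  rwa [(Nat.prime_dvd_prime_iff_eq hq (hL r hr)).1 hqr]

theorem one_lt_norm_eval {f : ℂ[X]} (hd : 0 < f.natDegree) (hl : 1 ≤ ‖f.leadingCoeff‖) {z : ℂ}
    (h : ∀ r ∈ f.roots, 1 < ‖z - r‖) : 1 < ‖f.eval z‖ := by
  rw [(IsAlgClosed.splits f).eval_eq_prod_roots, norm_mul]
  have hc : 0 < Multiset.card f.roots := by
    rwa [← (IsAlgClosed.splits f).natDegree_eq_card_roots]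
  have key : ∀ s : Multiset ℂ, (∀ r ∈ s, 1 < ‖z - r‖) → 1 ≤ ‖(s.map fun r => z - r).prod‖ ∧
      (0 < Multiset.card s → 1 < ‖(s.map fun r => z - r).prod‖) := by
    intro s
    induction s using Multiset.induction with
    | empty => simp
    | cons a s ih =>
      intro hs
      have h1 := hs a (Multiset.mem_cons_self a s)
      have h2 := (ih fun r hr => hs r (Multiset.mem_cons_of_mem hr)).1
      have : 1 < ‖((a ::ₘ s).map fun r => z - r).prod‖ := by
        rw [Multiset.map_cons, Multiset.prod_cons, norm_mul]
        nlinarith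
      exact ⟨this.le, fun _ => this⟩
  have := (key _ h).2 hc
  nlinarith

/-- An integer polynomial with a prime value at an integer far from all complex roots is
irreducible. -/
theorem irreducible_of_prime_value {H : ℤ[X]} {N : ℤ} (hd : 0 < H.natDegree)
    (hp : Prime (H.eval N)) (h : ∀ z : ℂ, aeval z H = 0 → 1 < ‖(N : ℂ) - z‖) : Irreducible H := by
  have hH : H ≠ 0 := by rintro rfl; simp at hd
  -- The roots of a factor are roots of `H`, hence farther than `1` from `N`; in positive degree the
  -- value at `N` would exceed `1` in modulus.
  have main : ∀ f : ℤ[X], f ∣ H → IsUnit (f.eval N) → IsUnit f := by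
    intro f hf hu
    rcases Nat.eq_zero_or_pos f.natDegree with h0 | h0
    · rw [eq_C_of_natDegree_eq_zero h0] at hu ⊢
      rw [eval_C] at hu
      exact hu.map C
    · exfalso
      have hf0 : f ≠ 0 := by rintro rfl; simp at h0
      have hinj : Function.Injective (algebraMap ℤ ℂ) := (algebraMap ℤ ℂ).injective_int
      have h1 : 1 < ‖(f.map (algebraMap ℤ ℂ)).eval (N : ℂ)‖ := by
        refine one_lt_norm_eval ?_ ?_ ?_
        · rwa [natDegree_map_eq_of_injective hinj]
        · rw [leadingCoeff_map_of_injective hinj]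
          simp only [algebraMap_int_eq, eq_intCast, Complex.norm_intCast]
          exact_mod_cast Int.one_le_abs (leadingCoeff_ne_zero.2 hf0)
        · intro r hr
          refine h r ?_
          obtain ⟨g, rfl⟩ := hf
          have : aeval r f = 0 := by
            have := isRoot_of_mem_roots hr
            rwa [IsRoot, eval_map_algebraMap] at this
          rw [map_mul, this, zero_mul]
      have h2 : (f.map (algebraMap ℤ ℂ)).eval (N : ℂ) = ((f.eval N : ℤ) : ℂ) := by simp
      rw [h2, Complex.norm_intCast] at h1
      rcases Int.isUnit_iff.1 hu with h | h <;> rw [h] at h1 <;> norm_num at h1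
  refine ⟨fun hu => ?_, fun {f g} hfg => ?_⟩
  · have := natDegree_eq_zero_of_isUnit hu
    omega
  · rcases hp.irreducible.isUnit_or_isUnit (by rw [← eval_mul, ← hfg]) with hu | hu
    · exact Or.inl (main f ⟨g, hfg⟩ hu)
    · exact Or.inr (main g ⟨f, by rw [hfg, mul_comm]⟩ hu)

theorem natDegree_ofList {L : List ℤ} {n : ℕ} (hL : L.length = n + 1) (hn : L.getD n 0 ≠ 0) :
    (ofList L).natDegree = n := by
  refine natDegree_eq_of_le_of_coeff_ne_zero ?_ (by rwa [coeff_ofList])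
  rw [natDegree_le_iff_coeff_eq_zero]
  intro m hm
  rw [coeff_ofList, List.getD_eq_default _ _ (by omega)]

theorem norm_root_lt {L : List ℤ} {n : ℕ} (hL : L.length = n + 1) {R : ℕ}
    (hn : L.getD n 0 ≠ 0) (hR : ∀ c ∈ L, |c| ≤ R * |L.getD n 0|) {z : ℂ}
    (hz : aeval z (ofList L) = 0) : ‖z‖ < R + 1 := by
  have hinj : Function.Injective (algebraMap ℤ ℂ) := (algebraMap ℤ ℂ).injective_int
  have hd := natDegree_ofList hL hn
  set p := (ofList L).map (algebraMap ℤ ℂ) with hp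
  have hp0 : p ≠ 0 := by
    intro h
    rw [hp, Polynomial.map_eq_zero_iff hinj] at h
    have := congrArg (fun f => f.coeff n) h
    simp only [coeff_ofList, coeff_zero] at this
    exact hn this
  have hroot : p.IsRoot z := by rwa [IsRoot, hp, eval_map_algebraMap]
  have h1 := hroot.norm_lt_cauchyBound hp0
  have hlead : ‖p.leadingCoeff‖₊ = Real.nnabs (L.getD n 0) := by
    rw [hp, leadingCoeff_map_of_injective hinj, leadingCoeff, hd, coeff_ofList]
    ext
    simp [Int.norm_eq_abs]
  have h2 : cauchyBound p ≤ R + 1 := by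
    rw [cauchyBound]
    gcongr
    refine div_le_of_le_mul₀ (by positivity) (by positivity) ?_
    refine Finset.sup_le fun i _ => ?_
    rw [hlead, hp, coeff_map, coeff_ofList]
    rw [← NNReal.coe_le_coe]
    simp only [algebraMap_int_eq, eq_intCast, coe_nnnorm, Complex.norm_intCast, NNReal.coe_mul,
      NNReal.coe_natCast, Real.coe_nnabs]
    have : |L.getD i 0| ≤ R * |L.getD n 0| := by
      rcases lt_or_ge i L.length with hi | hi
      · rw [List.getD_eq_getElem _ _ hi]
        exact hR _ (List.getElem_mem hi)
      · rw [List.getD_eq_default _ _ hi]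
        simp only [abs_zero]
        positivity
    exact_mod_cast this
  have := h1.trans_le h2
  exact_mod_cast this

/-! ### The number field -/

/-- The polynomial of degree `16` that defines the field. -/
def fieldPoly : List ℤ :=
    [-1059340775983631175351487184819983, 5251236165282846400361442133230076,
    8212087220131071659546646331664203, -59009003862726894641548124619308664,
    -6501284892376328531845183218909454, 174624008396402163707093920344029342,
    40914844108844787893933081071889661, -109887001109469010259185287064305894,
    -225377234652672792214679128671868769, -287219021740820532895988013382278880,
    138992075646371835226889344394742465, 397796702369991338051457337231131204,
    222229163853834724641998998061391568, 59222967331435906047960616600216646,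
    16331614198047476745691459998512495, 5000850608682290262645186738412954,
    654517540785327536432072280661174]

/-- The numerator of `α` as a rational function of a root of `fieldPoly`. -/
def numAlpha : List ℤ :=
    [-18176340224775624962045536746000317326502304317250658728911652572729428562581,
    231515595123636406929047622285191929358575134157087640119070096399454935471701,
    -701707201865050539347023367919937906043358270993464950725667425974228179951752,
    -471344983105774416087894328101953676717144809533682205684632468624930846910464,
    3130599839344854761275382123948937125857545477532302597065398719755176419998990,
    617807684749578936807630416095309208128276611290558969886943947656908103277876,
    -2508539721121755373824332793596940572934430049800630273487742815857653009904053,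
    -3915571585185735776041625295991885205450689463332728690035250583927449103418417,
    -5699135657476020660246771755453233323118547180611577597251466285585838632850582,
    2836065327346094963332250843910518986902703086489409536508978705599903575736006,
    8883311237476377093322702581522259172440871591466173636455385305006619982275445,
    5218258001456345611135742951268600063246298240892469226904395499124547916162163,
    1443349689493933588329530696202735449240535266263817002404098229660197941701337,
    388817651528643660253961229139607679609582174062707815869307592557883969253765,
    116085680678125375952086514278544654078359942295672963529749043041924005680204,
    15277305661931963830726071993568431926498015202375140247984715123216693021226]

/-- The denominator of `α` as a rational function of a root of `fieldPoly`. -/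
def denAlpha : List ℤ :=
    [1390997874837444377772056113208913342190072735150636713854684430957507203452,
    4350593083854107009274375755308294782987570823413085108242049238297590507862,
    -46892615216196349268157798459019372225065466630620626421937944472912567060584,
    -6888491154745968310779084260958869707516329900751886620417857846420613573432,
    231280423246692891771013441899126890464231459265024776112934743541680889267670,
    65027501426391815998991705080395359721676873474275619641785621320797206999982,
    -203755470413334095268405852716924458369177839563128385168674283109601428342666,
    -477600693735657841314092749092117422533475679415625052119316534711471917136904,
    -684731999573983333824668075520049730289735100589923048854272924685802611855840,
    368175560492878380609562810779716164166616963337944923562755327261018563663050,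
    1159094326016885380734121734322631991572686964347846437885553336091028510574188,
    706394345829470926660514754909861527129061266432776969312957220563016051370432,
    203938129687421599768809341632610971066249144113743153890481803242088254042446,
    60565047729662797327989461468094029160058158393934015457217216944312987862610,
    19870100153880415420869413950028685079503699647756282572723144670878657692870,
    2773998288007852227628908596377836462867574213377911103498252372699824764768]

/-- The coefficient of `t ^ 0` in the quartic factor of `piPoly`, cleared of denominators. -/
def quartic0 : List ℤ :=
  addL (mulL denAlpha [4064832, -8790912, -1695168])
    (mulL numAlpha [1452096, 1152864, -2032992])

/-- The coefficient of `t ^ 1` in the quartic factor of `piPoly`, cleared of denominators. -/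
def quartic1 : List ℤ :=
  addL (mulL denAlpha [44327232, -101056896, -24811200])
    (mulL numAlpha [9778032, 45903456, -12500496])

/-- The coefficient of `t ^ 2` in the quartic factor of `piPoly`, cleared of denominators. -/
def quartic2 : List ℤ :=
  addL (mulL denAlpha [147891456, -327456000, -111306240])
    (mulL numAlpha [69278256, 213385536, 1785744])

/-- The coefficient of `t ^ 3` in the quartic factor of `piPoly`, cleared of denominators. -/
def quartic3 : List ℤ :=
  addL (mulL denAlpha [196806528, -354461184, -149293440])
    (mulL numAlpha [209083104, 362727936, 66118176])

/-- The coefficient of `t ^ 4` in the quartic factor of `piPoly`, cleared of denominators. -/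
def quartic4 : List ℤ :=
  addL (mulL denAlpha [112025088, -65931264, -46093824])
    (mulL numAlpha [196043904, 220695552, 57617280])

/-! ### Primality certificates and irreducibility of the field polynomial -/

theorem prime_183303769547 : Nat.Prime 183303769547 := by
  refine prime_of_factors 2 [2, 46271, 1980763] ?_ (by norm_num) ?_ ?_
  · simp only [List.forall_mem_cons]
    exact ⟨by norm_num, by norm_num, by norm_num, by simp⟩
  · norm_num1
    reduce_mod_char
  · simp only [List.forall_mem_cons]
    refine ⟨?_, ?_, ?_, by simp⟩ <;> (norm_num1; reduce_mod_char; decide +kernel)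

theorem prime_781012247 : Nat.Prime 781012247 := by
  refine prime_of_factors 5 [2, 7, 2617, 21317] ?_ (by norm_num) ?_ ?_
  · simp only [List.forall_mem_cons]
    exact ⟨by norm_num, by norm_num, by norm_num, by norm_num, by simp⟩
  · norm_num1
    reduce_mod_char
  · simp only [List.forall_mem_cons]
    refine ⟨?_, ?_, ?_, ?_, by simp⟩ <;> (norm_num1; reduce_mod_char; decide +kernel)

theorem prime_165085682697379 : Nat.Prime 165085682697379 := by
  refine prime_of_factors 2 [2, 3, 3, 11743, 781012247] ?_ (by norm_num) ?_ ?_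
  · simp only [List.forall_mem_cons]
    exact ⟨by norm_num, by norm_num, by norm_num, by norm_num, prime_781012247, by simp⟩
  · norm_num1
    reduce_mod_char
  · simp only [List.forall_mem_cons]
    refine ⟨?_, ?_, ?_, ?_, ?_, by simp⟩ <;> (norm_num1; reduce_mod_char; decide +kernel)

theorem prime_185776458121333 : Nat.Prime 185776458121333 := by
  refine prime_of_factors 5 [2, 2, 3, 3, 13, 293, 839, 1614787] ?_ (by norm_num) ?_ ?_
  · simp only [List.forall_mem_cons]
    exact ⟨by norm_num, by norm_num, by norm_num, by norm_num, by norm_num, by norm_num, by norm_num, by norm_num, by simp⟩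
  · norm_num1
    reduce_mod_char
  · simp only [List.forall_mem_cons]
    refine ⟨?_, ?_, ?_, ?_, ?_, ?_, ?_, ?_, by simp⟩ <;> (norm_num1; reduce_mod_char; decide +kernel)

theorem prime_451861_71 : Nat.Prime 45186173251570689465982401044063587471329674004669121177532527697461501 := by
  refine prime_of_factors 13 [2, 2, 3, 5, 5, 5, 197, 2659, 3343, 16699, 1892489, 96827351,
    183303769547, 165085682697379, 185776458121333] ?_ (by norm_num) ?_ ?_
  · simp only [List.forall_mem_cons]
    exact ⟨by norm_num, by norm_num, by norm_num, by norm_num, by norm_num, by norm_num, by norm_num, by norm_num, by norm_num, by norm_num, by norm_num, by norm_num, prime_183303769547, prime_165085682697379, prime_185776458121333, by simp⟩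
  · norm_num1
    reduce_mod_char
  · simp only [List.forall_mem_cons]
    refine ⟨?_, ?_, ?_, ?_, ?_, ?_, ?_, ?_, ?_, ?_, ?_, ?_, ?_, ?_, ?_, by simp⟩ <;> (norm_num1; reduce_mod_char; decide +kernel)

theorem prime_188015_87 : Nat.Prime 188015851091996740214347921131313778967323200941007591063903673718433172305552388663429 := by
  refine prime_of_factors 2 [2, 2, 19, 37, 1013, 1069, 1366427,
    45186173251570689465982401044063587471329674004669121177532527697461501] ?_ (by norm_num) ?_ ?_
  · simp only [List.forall_mem_cons]
    exact ⟨by norm_num, by norm_num, by norm_num, by norm_num, by norm_num, by norm_num, by norm_num, prime_451861_71, by simp⟩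
  · norm_num1
    reduce_mod_char
  · simp only [List.forall_mem_cons]
    refine ⟨?_, ?_, ?_, ?_, ?_, ?_, ?_, ?_, by simp⟩ <;> (norm_num1; reduce_mod_char; decide +kernel)

theorem fieldPoly_length : fieldPoly.length = 16 + 1 := rfl

theorem fieldPoly_lead : fieldPoly.getD 16 0 ≠ 0 := by decide +kernel

theorem fieldPoly_irreducible : Irreducible (ofList fieldPoly) := by
  refine irreducible_of_prime_value (N := -2194) ?_ ?_ ?_
  · rw [natDegree_ofList fieldPoly_length fieldPoly_lead]
    norm_num
  · have : (ofList fieldPoly).eval (-2194) =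
        (188015851091996740214347921131313778967323200941007591063903673718433172305552388663429 : ℕ) := by
      simp only [fieldPoly, ofList, eval_add, eval_mul, eval_C, eval_X, eval_zero]
      norm_num
    rw [this]
    exact Nat.prime_iff_prime_int.1 prime_188015_87
  · intro z hz
    -- Cauchy's bound puts all roots in modulus below `609`, far from `-2194`.
    have h := norm_root_lt (R := 608) fieldPoly_length fieldPoly_lead (by decide +kernel) hz
    have h2 := norm_sub_norm_le (((-2194 : ℤ) : ℂ)) z
    rw [Complex.norm_intCast] at h2
    norm_num at h h2
    push_cast
    linarith

theorem fieldPoly_irreducible_rat : Irreducible ((ofList fieldPoly).map (Int.castRingHom ℚ)) := by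
  have hp := fieldPoly_irreducible.isPrimitive (by
    rw [natDegree_ofList fieldPoly_length fieldPoly_lead]; norm_num)
  exact (IsPrimitive.Int.irreducible_iff_irreducible_map_cast hp).1 fieldPoly_irreducible

/-- The first condition for a quartic to be the square of a quadratic. -/
theorem fieldPoly_dvd_cubic : ofList fieldPoly ∣ ofList
    (addL (mulL quartic3 (mulL quartic3 quartic3)) (addL
      (smulL (-4) (mulL quartic4 (mulL quartic3 quartic2)))
      (smulL 8 (mulL quartic4 (mulL quartic4 quartic1))))) :=
  ofList_dvd (by decide +kernel)

/-- The second condition for a quartic to be the square of a quadratic. -/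
theorem fieldPoly_dvd_cubic' : ofList fieldPoly ∣ ofList
    (addL (mulL quartic4 (mulL quartic1 quartic1))
      (smulL (-1) (mulL quartic3 (mulL quartic3 quartic0)))) :=
  ofList_dvd (by decide +kernel)

/-- A multiple, by a square, of the discriminant of the quadratic. -/
def discList : List ℤ := addL (smulL 3 (mulL quartic3 quartic3)) (smulL (-8) (mulL quartic2 quartic4))

/-! ### Two real roots of the field polynomial -/

theorem exists_root_disc_neg : ∃ y : ℝ, ev fieldPoly y = 0 ∧ ev discList y < 0 := by
  obtain ⟨y, hy, h1, h2⟩ := exists_root (S := 10 ^ 10) (a := 2603610660) (b := 2603610661)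
    (by norm_num) (by norm_num) (by norm_num) fieldPoly (by decide +kernel)
  exact ⟨y, hy, ev_neg (by norm_num) (by norm_num) h1 h2 _ (by decide +kernel)⟩

/-- The integer polynomial with value `8 a ^ 2 (T ^ 2 t ^ 2 + T m t + n)`, scaled. -/
def quadAt (k : ℤ) : List ℤ :=
  addL (smulL (8 * k ^ 2) (mulL quartic4 quartic4)) (addL
    (smulL (4 * k * 10 ^ 4) (mulL quartic4 quartic3))
    (smulL (10 ^ 8) (addL (smulL 4 (mulL quartic4 quartic2)) (smulL (-1) (mulL quartic3 quartic3)))))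

/-- The sign conditions encode decimal windows after clearing the negative quantities `denAlpha` and
`quartic4`: `-0.0312 < α < -0.0311`, `0.13 < m < 0.15`, and a sign change of `t ^ 2 + m t + n`
between `0.1765` and `0.1766`. -/
theorem exists_root_data : ∃ x : ℝ, ev fieldPoly x = 0 ∧ 0.401479 < x ∧ x < 0.40148 ∧
    ev denAlpha x < 0 ∧ ev (addL (smulL (10 ^ 4) numAlpha) (smulL 312 denAlpha)) x < 0 ∧
    0 < ev (addL (smulL (10 ^ 4) numAlpha) (smulL 311 denAlpha)) x ∧
    ev quartic4 x < 0 ∧ ev quartic3 x < 0 ∧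
    ev (addL (smulL 50 quartic3) (smulL (-13) quartic4)) x < 0 ∧
    0 < ev (addL (smulL 50 quartic3) (smulL (-15) quartic4)) x ∧
    ev (quadAt 1765) x < 0 ∧ 0 < ev (quadAt 1766) x := by
  obtain ⟨x, hx, h1, h2⟩ := exists_root (S := 10 ^ 20) (a := 40147902009460675235)
    (b := 40147902009460675236) (by norm_num) (by norm_num) (by norm_num) fieldPoly
    (by decide +kernel)
  have neg := fun L => ev_neg (L := L) (by norm_num) (by norm_num) h1 h2
  have pos := fun L => ev_pos (L := L) (by norm_num) (by norm_num) h1 h2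
  push_cast at h1 h2
  exact ⟨x, hx, by linarith, by linarith, neg _ (by decide +kernel), neg _ (by decide +kernel),
    pos _ (by decide +kernel), neg _ (by decide +kernel), neg _ (by decide +kernel),
    neg _ (by decide +kernel), pos _ (by decide +kernel), neg _ (by decide +kernel),
    pos _ (by decide +kernel)⟩

theorem ev_mem_adjoin (L : List ℤ) (x : ℝ) : ev L x ∈ IntermediateField.adjoin ℚ {x} := by
  induction L with
  | nil => rw [ev_nil]; exact zero_mem _
  | cons c L ih =>
    rw [ev_cons]
    exact add_mem (intCast_mem _ c) (mul_mem (IntermediateField.mem_adjoin_simple_self ℚ x) ih)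

theorem aeval_map_rat (L : List ℤ) (x : ℝ) :
    aeval x ((ofList L).map (Int.castRingHom ℚ)) = ev L x := by
  rw [ev, ← algebraMap_int_eq, aeval_map_algebraMap]

theorem isAlgebraic_of_root {x : ℝ} (hx : ev fieldPoly x = 0) : IsAlgebraic ℚ x :=
  ⟨_, fieldPoly_irreducible_rat.ne_zero, by rw [aeval_map_rat, hx]⟩

/-- The discriminant is not a square in the field, since it is negative in another real
embedding. -/
theorem sq_ne_disc {x s : ℝ} (hx : ev fieldPoly x = 0)
    (hs : s ∈ IntermediateField.adjoin ℚ {x}) : s ^ 2 ≠ ev discList x := by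
  intro h
  obtain ⟨y, hy, hneg⟩ := exists_root_disc_neg
  have hs' : s ∈ (IntermediateField.adjoin ℚ {x}).toSubalgebra := hs
  rw [IntermediateField.adjoin_simple_toSubalgebra_of_isAlgebraic (isAlgebraic_of_root hx),
    Algebra.adjoin_singleton_eq_range_aeval] at hs'
  obtain ⟨P, rfl⟩ := hs'
  -- With `s = P(x)`, the difference `P ^ 2 - disc` vanishes at `x`, hence at every root of the
  -- irreducible `fieldPoly`; at `y` it is positive.
  have hdvd : (ofList fieldPoly).map (Int.castRingHom ℚ) ∣
      P ^ 2 - (ofList discList).map (Int.castRingHom ℚ) := by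
    have h1 := minpoly.dvd ℚ x (p := P ^ 2 - (ofList discList).map (Int.castRingHom ℚ)) (by
      rw [map_sub, map_pow, aeval_map_rat, ← h]
      exact sub_self _)
    rw [← minpoly.eq_of_irreducible fieldPoly_irreducible_rat (by rw [aeval_map_rat, hx])] at h1
    exact (dvd_mul_right _ _).trans h1
  obtain ⟨W, hW⟩ := hdvd
  have := congrArg (aeval y) hW
  rw [map_sub, map_pow, map_mul, aeval_map_rat, aeval_map_rat, hy, zero_mul] at this
  nlinarith [sq_nonneg (aeval y P)]

/-! ### From the field to the factorization of the quintic -/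

/-- In `a (t ^ 2 + m t + n) ^ 2` the coefficients `b` and `c` determine `m` and `n`; the two
equations say that `d` and `e` fit. Recovering `e` requires dividing by `b ^ 2`. -/
theorem quartic_square {a b c d e : ℝ} (ha : a ≠ 0) (hb : b ≠ 0)
    (h1 : b ^ 3 - 4 * (a * b * c) + 8 * (a ^ 2 * d) = 0) (h2 : a * d ^ 2 - b ^ 2 * e = 0)
    {m n : ℝ} (hm : m = b / (2 * a)) (hn : n = (4 * a * c - b ^ 2) / (8 * a ^ 2)) :
    b = a * (2 * m) ∧ c = a * (m ^ 2 + 2 * n) ∧ d = a * (2 * m * n) ∧ e = a * n ^ 2 := by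
  have e1 : b = a * (2 * m) := by rw [hm]; field_simp
  have e2 : c = a * (m ^ 2 + 2 * n) := by rw [hm, hn]; field_simp; ring
  have e3 : d = a * (2 * m * n) := by
    have : 8 * a ^ 2 * d = 8 * a ^ 2 * (a * (2 * m * n)) := by
      rw [e1, e2] at h1
      linear_combination h1
    exact mul_left_cancel₀ (by positivity) this
  refine ⟨e1, e2, e3, mul_left_cancel₀ (pow_ne_zero 2 hb) ?_⟩
  rw [e3] at h2
  rw [e1] at h2 ⊢
  linear_combination -h2

theorem piPoly_eq {α β γ m n k : ℝ}
    (h0 : -96 * α - 96 * β - 48 * α * β - 192 * γ - 96 * α * γ - 96 * β * γ + 99 * α * β * γ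
      = -k * (2 * n ^ 2))
    (h1 : -1392 * α - 1296 * β - 96 * α * β - 1696 * γ - 1624 * α * γ - 952 * β * γ
      + 1370 * α * β * γ = -k * (n ^ 2 + 4 * m * n))
    (h2 : -256 - 8608 * α - 5488 * β + 1172 * α * β - 5536 * γ - 10240 * α * γ - 2164 * β * γ
      + 4292 * α * β * γ = -k * (2 * m * n + 2 * m ^ 2 + 4 * n))
    (h3 : -2944 - 25648 * α - 8512 * β + 4100 * α * β - 8192 * γ - 21056 * α * γ - 1736 * β * γ
      + 4768 * α * β * γ = -k * (m ^ 2 + 2 * n + 4 * m))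
    (h4 : -8576 - 32288 * α - 4832 * β + 4072 * α * β - 2912 * γ - 12608 * α * γ - 440 * β * γ
      + 1744 * α * β * γ = -k * (2 * m + 2))
    (h5 : -3584 - 11648 * α - 896 * β + 1120 * α * β = -k) (hk : 0 ≤ k) :
    piPoly α β γ = (-X - 2) * (C (√k) * (X ^ 2 + C m * X + C n)) ^ 2 := by
  have hC : C (√k) ^ 2 = C k := by rw [← C_pow, Real.sq_sqrt hk]
  rw [piPoly, h0, h1, h2, h3, h4, h5, mul_pow, hC]
  simp only [map_mul, map_add, map_neg, map_pow, map_ofNat]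
  ring

/-- The coefficient of `t ^ 0` in `π (t) (1429 β - 23696) / (t + 2)`, for `β = 2 - 6 x`. -/
def quarticCoeff0 (x α : ℝ) : ℝ :=
  (4064832 - 8790912 * x - 1695168 * x ^ 2)
    + α * (1452096 + 1152864 * x - 2032992 * x ^ 2)

theorem ev_quartic0 {x α : ℝ} (h : ev numAlpha x = ev denAlpha x * α) :
    ev quartic0 x = ev denAlpha x * quarticCoeff0 x α := by
  rw [quarticCoeff0, quartic0, ev_addL, ev_mulL, ev_mulL, h]
  simp only [ev_cons, ev_nil]
  push_cast
  ring

/-- The coefficient of `t ^ 1` in `π (t) (1429 β - 23696) / (t + 2)`, for `β = 2 - 6 x`. -/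
def quarticCoeff1 (x α : ℝ) : ℝ :=
  (44327232 - 101056896 * x - 24811200 * x ^ 2)
    + α * (9778032 + 45903456 * x - 12500496 * x ^ 2)

theorem ev_quartic1 {x α : ℝ} (h : ev numAlpha x = ev denAlpha x * α) :
    ev quartic1 x = ev denAlpha x * quarticCoeff1 x α := by
  rw [quarticCoeff1, quartic1, ev_addL, ev_mulL, ev_mulL, h]
  simp only [ev_cons, ev_nil]
  push_cast
  ring

/-- The coefficient of `t ^ 2` in `π (t) (1429 β - 23696) / (t + 2)`, for `β = 2 - 6 x`. -/
def quarticCoeff2 (x α : ℝ) : ℝ :=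
  (147891456 - 327456000 * x - 111306240 * x ^ 2)
    + α * (69278256 + 213385536 * x + 1785744 * x ^ 2)

theorem ev_quartic2 {x α : ℝ} (h : ev numAlpha x = ev denAlpha x * α) :
    ev quartic2 x = ev denAlpha x * quarticCoeff2 x α := by
  rw [quarticCoeff2, quartic2, ev_addL, ev_mulL, ev_mulL, h]
  simp only [ev_cons, ev_nil]
  push_cast
  ring

/-- The coefficient of `t ^ 3` in `π (t) (1429 β - 23696) / (t + 2)`, for `β = 2 - 6 x`. -/
def quarticCoeff3 (x α : ℝ) : ℝ :=
  (196806528 - 354461184 * x - 149293440 * x ^ 2)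
    + α * (209083104 + 362727936 * x + 66118176 * x ^ 2)

theorem ev_quartic3 {x α : ℝ} (h : ev numAlpha x = ev denAlpha x * α) :
    ev quartic3 x = ev denAlpha x * quarticCoeff3 x α := by
  rw [quarticCoeff3, quartic3, ev_addL, ev_mulL, ev_mulL, h]
  simp only [ev_cons, ev_nil]
  push_cast
  ring

/-- The coefficient of `t ^ 4` in `π (t) (1429 β - 23696) / (t + 2)`, for `β = 2 - 6 x`. -/
def quarticCoeff4 (x α : ℝ) : ℝ :=
  (112025088 - 65931264 * x - 46093824 * x ^ 2)
    + α * (196043904 + 220695552 * x + 57617280 * x ^ 2)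

theorem ev_quartic4 {x α : ℝ} (h : ev numAlpha x = ev denAlpha x * α) :
    ev quartic4 x = ev denAlpha x * quarticCoeff4 x α := by
  rw [quarticCoeff4, quartic4, ev_addL, ev_mulL, ev_mulL, h]
  simp only [ev_cons, ev_nil]
  push_cast
  ring

theorem exists_quartic_data : ∃ x α m n : ℝ, ev fieldPoly x = 0 ∧ 0.401479 < x ∧ x < 0.40148 ∧
    α ∈ IntermediateField.adjoin ℚ {x} ∧ -0.0312 < α ∧ α ≤ -0.0311 ∧ 0.13 < m ∧ m < 0.15 ∧
    (1765 / 10 ^ 4) ^ 2 + m * (1765 / 10 ^ 4) + n < 0 ∧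
    0 < (1766 / 10 ^ 4) ^ 2 + m * (1766 / 10 ^ 4) + n ∧
    quarticCoeff4 x α ≠ 0 ∧
    quarticCoeff3 x α = quarticCoeff4 x α * (2 * m) ∧
    quarticCoeff2 x α = quarticCoeff4 x α * (m ^ 2 + 2 * n) ∧
    quarticCoeff1 x α = quarticCoeff4 x α * (2 * m * n) ∧
    quarticCoeff0 x α = quarticCoeff4 x α * n ^ 2 ∧
    ∀ τ ∈ IntermediateField.adjoin ℚ {x}, τ ^ 2 + m * τ + n ≠ 0 := by
  obtain ⟨x, hx, hx1, hx2, hD, hα1, hα2, ha, hb, hm1, hm2, hU1, hU2⟩ := exists_root_data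
  obtain ⟨α, hα⟩ : ∃ α, α = ev numAlpha x / ev denAlpha x := ⟨_, rfl⟩
  have hD0 : ev denAlpha x ≠ 0 := hD.ne
  have hNα : ev numAlpha x = ev denAlpha x * α := by rw [hα, mul_div_cancel₀ _ hD0]
  have hQ0 := ev_quartic0 hNα
  have hQ1 := ev_quartic1 hNα
  have hQ2 := ev_quartic2 hNα
  have hQ3 := ev_quartic3 hNα
  have hQ4 := ev_quartic4 hNα
  have hE1 := ev_eq_zero_of_dvd fieldPoly_dvd_cubic hx
  have hE2 := ev_eq_zero_of_dvd fieldPoly_dvd_cubic' hx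
  have hαK : α ∈ IntermediateField.adjoin ℚ {x} := by
    rw [hα]; exact div_mem (ev_mem_adjoin _ _) (ev_mem_adjoin _ _)
  have hnot := fun s => sq_ne_disc (s := s) hx
  have h3K := ev_mem_adjoin quartic3 x
  have h4K := ev_mem_adjoin quartic4 x
  -- Every cleared expression becomes a power of `D = denAlpha(x)` times one in `α` and the quartic
  -- coefficients.
  simp only [discList, quadAt, ev_addL, ev_smulL, ev_mulL, hNα, hQ0, hQ1, hQ2, hQ3, hQ4]
    at hα1 hα2 ha hb hm1 hm2 hU1 hU2 hE1 hE2 hnot h3K h4K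
  clear hQ0 hQ1 hQ2 hQ3 hQ4 hα hNα
  generalize ev denAlpha x = D at *
  generalize hq0 : quarticCoeff0 x α = q0 at *
  generalize hq1 : quarticCoeff1 x α = q1 at *
  generalize hq2 : quarticCoeff2 x α = q2 at *
  generalize hq3 : quarticCoeff3 x α = q3 at *
  generalize hq4 : quarticCoeff4 x α = q4 at *
  push_cast at hα1 hα2 hm1 hm2 hU1 hU2 hE1 hE2 hnot
  have hα3 : 0 < 10 ^ 4 * α + 312 :=
    pos_of_mul_neg_right (a := D) (by linear_combination hα1) hD.le
  have hα4 : 10 ^ 4 * α + 311 < 0 := by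
    by_contra! h
    have := mul_nonpos_of_nonpos_of_nonneg hD.le h
    linarith only [this, hα2]
  have hq4pos : 0 < q4 := pos_of_mul_neg_right ha hD.le
  have hq3pos : 0 < q3 := pos_of_mul_neg_right hb hD.le
  have hE1' : q3 ^ 3 - 4 * (q4 * q3 * q2) + 8 * (q4 ^ 2 * q1) = 0 := by
    refine mul_left_cancel₀ (pow_ne_zero 3 hD0) ?_
    linear_combination hE1
  have hE2' : q4 * q1 ^ 2 - q3 ^ 2 * q0 = 0 := by
    refine mul_left_cancel₀ (pow_ne_zero 3 hD0) ?_
    linear_combination hE2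
  obtain ⟨m, hm⟩ : ∃ m, m = q3 / (2 * q4) := ⟨_, rfl⟩
  obtain ⟨n, hn⟩ : ∃ n, n = (4 * q4 * q2 - q3 ^ 2) / (8 * q4 ^ 2) := ⟨_, rfl⟩
  obtain ⟨s3, s2, s1, s0⟩ := quartic_square hq4pos.ne' hq3pos.ne' hE1' hE2' hm hn
  have hDq : D * q4 < 0 := mul_neg_of_neg_of_pos hD hq4pos
  rw [s3] at hm1 hm2
  rw [s2, s3] at hU1 hU2
  have hm3 : 0 < 100 * m - 13 :=
    pos_of_mul_neg_right (a := D * q4) (by linear_combination hm1) hDq.le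
  have hm4 : 100 * m - 15 < 0 := by
    by_contra! h
    have := mul_nonpos_of_nonpos_of_nonneg hDq.le h
    linarith only [this, hm2]
  have hsq : 0 ≤ 8 * 10 ^ 8 * (D * q4) ^ 2 := by positivity
  have hU1' : (1765 / 10 ^ 4) ^ 2 + m * (1765 / 10 ^ 4) + n < 0 :=
    neg_of_mul_neg_right (a := 8 * 10 ^ 8 * (D * q4) ^ 2) (by linear_combination hU1) hsq
  have hU2' : 0 < (1766 / 10 ^ 4) ^ 2 + m * (1766 / 10 ^ 4) + n :=
    pos_of_mul_pos_right (a := 8 * 10 ^ 8 * (D * q4) ^ 2) (by linear_combination hU2) hsq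
  refine ⟨x, α, m, n, hx, hx1, hx2, hαK, by linarith only [hα3], by linarith only [hα4],
    by linarith only [hm3], by linarith only [hm4], hU1', hU2', ?_⟩
  rw [hq0, hq1, hq2, hq3, hq4]
  refine ⟨hq4pos.ne', s3, s2, s1, s0, fun τ hτ h => ?_⟩
  -- At a root, `2 τ + m` squares to the discriminant `m ^ 2 - 4 n`; multiplying by `2 a`, with `a =
  -- D q4`, gives `4 a τ + b` and `3 b ^ 2 - 8 a c`.
  refine hnot (4 * (D * q4) * τ + D * q3) ?_ ?_
  · exact add_mem (mul_mem (mul_mem (ofNat_mem _ 4) h4K) hτ) h3K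
  · rw [s2, s3]
    linear_combination 16 * (D * q4) ^ 2 * h

/-- For this `γ` and any `α`, the product `(1429 β - 23696) π` is `t + 2` times the quartic with
coefficients `quarticCoeff`; `e0` to `e4` compare coefficients. -/
theorem piPoly_eq_of_quartic {x α β γ m n : ℝ} (hx : x = (2 - β) / 6)
    (hβ : 1429 * β - 23696 ≠ 0) (hγ : γ * (23696 - 1429 * β) = 9856 + 448 * β)
    (s3 : quarticCoeff3 x α = quarticCoeff4 x α * (2 * m))
    (s2 : quarticCoeff2 x α = quarticCoeff4 x α * (m ^ 2 + 2 * n))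
    (s1 : quarticCoeff1 x α = quarticCoeff4 x α * (2 * m * n))
    (s0 : quarticCoeff0 x α = quarticCoeff4 x α * n ^ 2)
    (hk : 0 ≤ 3584 + 11648 * α + 896 * β - 1120 * α * β) :
    piPoly α β γ = (-X - 2) *
      (C (√(3584 + 11648 * α + 896 * β - 1120 * α * β)) * (X ^ 2 + C m * X + C n)) ^ 2 := by
  generalize hk' : 3584 + 11648 * α + 896 * β - 1120 * α * β = k at *
  have hk4 : quarticCoeff4 x α = -k * (1429 * β - 23696) := by
    rw [← hk', quarticCoeff4, hx]; ring
  have e0 : ((-96) * α + (-96) * β + (-48) * α * β + ((-192) + (-96) * α + (-96) * β + 99 * α * β) * γ) *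
      (1429 * β - 23696) = 2 * quarticCoeff0 x α := by
    rw [quarticCoeff0, hx]
    linear_combination -((-192) + (-96) * α + (-96) * β + 99 * α * β) * hγ
  have e1 : ((-1392) * α + (-1296) * β + (-96) * α * β + ((-1696) + (-1624) * α + (-952) * β + 1370 * α * β) * γ) *
      (1429 * β - 23696) = quarticCoeff0 x α + 2 * quarticCoeff1 x α := by
    rw [quarticCoeff0, quarticCoeff1, hx]
    linear_combination -((-1696) + (-1624) * α + (-952) * β + 1370 * α * β) * hγ
  have e2 : ((-256) + (-8608) * α + (-5488) * β + 1172 * α * β + ((-5536) + (-10240) * α + (-2164) * β + 4292 * α * β) * γ) *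
      (1429 * β - 23696) = quarticCoeff1 x α + 2 * quarticCoeff2 x α := by
    rw [quarticCoeff1, quarticCoeff2, hx]
    linear_combination -((-5536) + (-10240) * α + (-2164) * β + 4292 * α * β) * hγ
  have e3 : ((-2944) + (-25648) * α + (-8512) * β + 4100 * α * β + ((-8192) + (-21056) * α + (-1736) * β + 4768 * α * β) * γ) *
      (1429 * β - 23696) = quarticCoeff2 x α + 2 * quarticCoeff3 x α := by
    rw [quarticCoeff2, quarticCoeff3, hx]
    linear_combination -((-8192) + (-21056) * α + (-1736) * β + 4768 * α * β) * hγ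
  have e4 : ((-8576) + (-32288) * α + (-4832) * β + 4072 * α * β + ((-2912) + (-12608) * α + (-440) * β + 1744 * α * β) * γ) *
      (1429 * β - 23696) = quarticCoeff3 x α + 2 * quarticCoeff4 x α := by
    rw [quarticCoeff3, quarticCoeff4, hx]
    linear_combination -((-2912) + (-12608) * α + (-440) * β + 1744 * α * β) * hγ
  refine piPoly_eq ?_ ?_ ?_ ?_ ?_ (by rw [← hk']; ring) hk
  · refine mul_right_cancel₀ hβ ?_
    linear_combination e0 + 2 * s0 + (2 * n ^ 2) * hk4
  · refine mul_right_cancel₀ hβ ?_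
    linear_combination e1 + s0 + 2 * s1 + (n ^ 2 + 4 * m * n) * hk4
  · refine mul_right_cancel₀ hβ ?_
    linear_combination e2 + s1 + 2 * s2 + (2 * m * n + 2 * m ^ 2 + 4 * n) * hk4
  · refine mul_right_cancel₀ hβ ?_
    linear_combination e3 + s2 + 2 * s3 + (m ^ 2 + 2 * n + 4 * m) * hk4
  · refine mul_right_cancel₀ hβ ?_
    linear_combination e4 + s3 + (2 * m + 2) * hk4

theorem quarticCoeff_mem {x α : ℝ} {F : Subfield ℝ} (hx : x ∈ F) (hα : α ∈ F) :
    quarticCoeff2 x α ∈ F ∧ quarticCoeff3 x α ∈ F ∧ quarticCoeff4 x α ∈ F := by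
  have h : ∀ a b c d e f : ℤ, (a + b * x + c * x ^ 2) + α * (d + e * x + f * x ^ 2) ∈ F :=
    fun a b c d e f =>
    add_mem (add_mem (add_mem (intCast_mem F a) (mul_mem (intCast_mem F b) hx))
      (mul_mem (intCast_mem F c) (pow_mem hx 2)))
      (mul_mem hα (add_mem (add_mem (intCast_mem F d) (mul_mem (intCast_mem F e) hx))
        (mul_mem (intCast_mem F f) (pow_mem hx 2))))
  refine ⟨?_, ?_, ?_⟩
  · convert h (147891456) (-327456000) (-111306240) (69278256) (213385536) (1785744) using 1
    rw [quarticCoeff2]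
    push_cast
    ring
  · convert h (196806528) (-354461184) (-149293440) (209083104) (362727936) (66118176) using 1
    rw [quarticCoeff3]
    push_cast
    ring
  · convert h (112025088) (-65931264) (-46093824) (196043904) (220695552) (57617280) using 1
    rw [quarticCoeff4]
    push_cast
    ring

theorem mem_of_quartic {x α m n : ℝ} {F : Subfield ℝ} (hx : x ∈ F) (hα : α ∈ F)
    (h : quarticCoeff4 x α ≠ 0) (s3 : quarticCoeff3 x α = quarticCoeff4 x α * (2 * m))
    (s2 : quarticCoeff2 x α = quarticCoeff4 x α * (m ^ 2 + 2 * n)) : m ∈ F ∧ n ∈ F := by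
  obtain ⟨h2, h3, h4⟩ := quarticCoeff_mem hx hα
  have hm : m ∈ F := by
    have : m = quarticCoeff3 x α / quarticCoeff4 x α / 2 := by rw [s3]; field_simp
    rw [this]
    exact div_mem (div_mem h3 h4) (ofNat_mem F 2)
  refine ⟨hm, ?_⟩
  have : n = (quarticCoeff2 x α / quarticCoeff4 x α - m ^ 2) / 2 := by rw [s2]; field_simp; ring
  rw [this]
  exact div_mem (sub_mem (div_mem h2 h4) (pow_mem hm 2)) (ofNat_mem F 2)

/-- The data of the explicit example, with the conjugate `τ'` of `τ`. -/
theorem exists_explicit_data : ∃ α β γ τ τ' : ℝ, IsExplicitData α β γ τ ∧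
    IsAlgebraic ℚ α ∧ IsAlgebraic ℚ β ∧ IsAlgebraic ℚ γ ∧ τ ∉ ratExt α β γ ∧
    τ + τ' ∈ ratExt α β γ ∧ τ * τ' ∈ ratExt α β γ ∧ -(3 / 8) ≤ τ' ∧ τ' < 0 := by
  obtain ⟨x, α, m, n, hx, hx1, hx2, hαK, hα1, hα2, hm1, hm2, hU1, hU2, hq4, s3, s2, s1, s0, hnot⟩ :=
    exists_quartic_data
  obtain ⟨β, hβ⟩ : ∃ β, β = 2 - 6 * x := ⟨_, rfl⟩
  have hx' : x = (2 - β) / 6 := by rw [hβ]; ring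
  have hβ1 : -0.4089 < β := by linarith only [hβ, hx2]
  have hβ2 : β ≤ -0.4088 := by linarith only [hβ, hx1]
  have hden : 0 < 23696 - 1429 * β := by linarith only [hβ2]
  have hden' : 1429 * β - 23696 ≠ 0 := (show 1429 * β - 23696 < 0 by linarith only [hden]).ne
  obtain ⟨γ, hγ⟩ : ∃ γ, γ = (9856 + 448 * β) / (23696 - 1429 * β) := ⟨_, rfl⟩
  have hγ' : γ * (23696 - 1429 * β) = 9856 + 448 * β := by rw [hγ, div_mul_cancel₀ _ hden.ne']
  have hγ1 : 0.3983 ≤ γ := by rw [hγ, le_div_iff₀ hden]; linarith only [hβ1]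
  have hγ2 : γ < 0.3984 := by rw [hγ, div_lt_iff₀ hden]; linarith only [hβ2]
  obtain ⟨τ, ⟨hτ1, hτ2⟩, hτ⟩ : (0 : ℝ) ∈ (fun t : ℝ => t ^ 2 + m * t + n) ''
      Set.Icc (1765 / 10 ^ 4) (1766 / 10 ^ 4) :=
    intermediate_value_Icc (by norm_num) (by fun_prop) ⟨hU1.le, hU2.le⟩
  replace hτ : τ ^ 2 + m * τ + n = 0 := hτ
  have hτ3 : τ < 1766 / 10 ^ 4 := lt_of_le_of_ne hτ2 fun h => by
    rw [← h, hτ] at hU2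
    exact hU2.false
  have hβK : β ∈ IntermediateField.adjoin ℚ {x} := by
    rw [hβ]
    exact sub_mem (ofNat_mem _ 2)
      (mul_mem (ofNat_mem _ 6) (IntermediateField.mem_adjoin_simple_self ℚ x))
  have hγK : γ ∈ IntermediateField.adjoin ℚ {x} := by
    rw [hγ]
    exact div_mem (add_mem (ofNat_mem _ 9856) (mul_mem (ofNat_mem _ 448) hβK))
      (sub_mem (ofNat_mem _ 23696) (mul_mem (ofNat_mem _ 1429) hβK))
  have hle : IntermediateField.adjoin ℚ ({α, β, γ} : Set ℝ) ≤ IntermediateField.adjoin ℚ {x} := by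
    rw [IntermediateField.adjoin_le_iff]
    rintro _ (rfl | rfl | rfl) <;> assumption
  have halg : ∀ z ∈ IntermediateField.adjoin ℚ {x}, IsAlgebraic ℚ z := by
    intro z hz
    have := IntermediateField.isAlgebraic_adjoin_simple (isAlgebraic_of_root hx).isIntegral
    exact (isAlgebraic_algebraMap_iff (A := ℝ) Subtype.val_injective).2
      (this.isAlgebraic (⟨z, hz⟩ : IntermediateField.adjoin ℚ {x}))
  have hαF : α ∈ ratExt α β γ := IntermediateField.subset_adjoin ℚ _ (by simp)
  have hβF : β ∈ ratExt α β γ := IntermediateField.subset_adjoin ℚ _ (by simp)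
  have hxF : x ∈ ratExt α β γ := by
    rw [hx']
    exact div_mem (sub_mem (ofNat_mem _ 2) hβF) (ofNat_mem _ 6)
  obtain ⟨hmF, hnF⟩ := mem_of_quartic hxF hαF hq4 s3 s2
  have hκ : 0 < 3584 + 11648 * α + 896 * β - 1120 * α * β := by
    nlinarith only [hα1, hα2, hβ1, hβ2]
  -- The conjugate is the other root `-m - τ`, between `-0.3266` and `-0.3065`, well inside `[-3/8,
  -- 0)`.
  refine ⟨α, β, γ, τ, -m - τ, ⟨⟨hα1, hα2⟩, ⟨hβ1, hβ2⟩, ⟨hγ1, hγ2⟩,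
    ⟨by linarith only [hτ1], by linarith only [hτ3]⟩, _, ?_,
    piPoly_eq_of_quartic hx' hden' hγ' s3 s2 s1 s0 hκ.le, ?_⟩,
    halg _ hαK, halg _ hβK, halg _ hγK, fun h => hnot τ (hle h) hτ, ?_, ?_,
    by linarith only [hm2, hτ3], by linarith only [hm1, hτ1]⟩
  · have : X ^ 2 + C m * X + C n = C 1 * X ^ 2 + C m * X + C n := by simp
    rw [natDegree_C_mul (Real.sqrt_pos.2 hκ).ne', this, natDegree_quadratic one_ne_zero]
  · simp only [IsRoot, eval_mul, eval_add, eval_pow, eval_X, eval_C]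
    rw [hτ, mul_zero]
  · have : τ + (-m - τ) = -m := by ring
    rw [this]
    exact neg_mem hmF
  · have : τ * (-m - τ) = n := by linear_combination -hτ
    rw [this]
    exact hnF

end NonnegRankField

end

theorem mainTheorem1 :
    ∃ α β γ τ : ℝ, NonnegRankField.IsExplicitData α β γ τ ∧
      IsAlgebraic ℚ α ∧ IsAlgebraic ℚ β ∧ IsAlgebraic ℚ γ ∧
      τ ∉ NonnegRankField.ratExt α β γ ∧
      -- the polytopes and the unique simplex between them
      (∃ P Q : Set (Fin 5 → ℝ),
        NonnegRankField.IsPolytope P ∧ NonnegRankField.IsPolytope Q ∧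
        P ⊆ Q ∧ Q ⊆ NonnegRankField.sumOne ∧
        NonnegRankField.polyDim P = 4 ∧ NonnegRankField.polyDim Q = 4 ∧
        NonnegRankField.VerticesIn (NonnegRankField.ratExt α β γ) P ∧
        NonnegRankField.VerticesIn (NonnegRankField.ratExt α β γ) Q ∧
        ∃ Δ : Set (Fin 5 → ℝ),
          (NonnegRankField.IsSimplex Δ ∧ P ⊆ Δ ∧ Δ ⊆ Q) ∧
          (∀ Δ' : Set (Fin 5 → ℝ),
            NonnegRankField.IsSimplex Δ' → P ⊆ Δ' → Δ' ⊆ Q → Δ' = Δ) ∧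
          NonnegRankField.Omega τ ∈ Δ.extremePoints ℝ ∧
          ∃ i, NonnegRankField.Omega τ i ∉ NonnegRankField.ratExt α β γ) ∧
      -- the matrix whose nonnegative rank depends on the field
      ∃ (m n : ℕ) (A : Matrix (Fin m) (Fin n) ℝ),
        (∀ i j, A i j ∈ NonnegRankField.ratExt α β γ ∧ 0 ≤ A i j) ∧
        NonnegRankField.nonnegRank ⊤ A = 5 ∧
        NonnegRankField.nonnegRank (NonnegRankField.ratExt α β γ) A
          ≠ NonnegRankField.nonnegRank ⊤ A := by
  obtain ⟨α, β, γ, τ, τ', hdata, hα, hβ, hγ, hτ, hadd, hmul, h1, h2⟩ :=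
    NonnegRankField.exists_explicit_data
  have h3 : 0 < τ := by linarith only [hdata.2.2.2.1.1]
  have h4 : τ < 1 / 2 := by linarith only [hdata.2.2.2.1.2]
  exact ⟨α, β, γ, τ, hdata, hα, hβ, hγ, hτ,
    NonnegRankField.exists_polytopes h3 h4 h1 h2 hadd hmul hτ,
    NonnegRankField.exists_matrix h3 h4 h1 h2 hadd hmul hτ⟩
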